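/- **Algorithm.** Let $d\ge 1$, $f:\mathbb R^d\to\mathbb R$, and let $\log^+\theta=\max\{1,\log\theta\}$, $B_R(z)=\{x:\|x-z\|\le R\}$. A *centre routine* is a map that assigns to a region $S$ a point $\mathrm{Centre}(S)$, with $\mathrm{Centre}(S)\in S$ if $S$ is nonempty, compact and convex, and that depends in a Borel way on the data (ball and half-spaces) describing $S$. Fix $e\neq0$ in $\mathbb R^d$. *CuttingPlaneMethod*$(\hat f,x^{(0)},R,N)$: put $S^{(0)}=B_R(x^{(0)})\cap H(x^{(0)})$ and, for $t=1,\dots,N$, $x^{(t)}=\mathrm{Centre}(S^{(t-1)})$, $S^{(t)}=S^{(t-1)}\cap H(x^{(t)})$. Here $H(x)=\{x':\nabla\hat f(x)^T(x'-x)\le 0\}$, with $e$ in place of $\nabla\hat f(x)$ if $\nabla\hat f(x)=0$. *Cutting plane assumption*, for $\tau\in(0,1/2]$: for all differentiable $\hat f$, all $x^{(0)}$, $R>0$ and $N\ge1$ the method yields $\mathrm{vol}(S^{(N)})\le(1-\tau)^N\,\mathrm{vol}(B_R(0))$; a call of Centre takes time $T_C$. *ExploitNC*$(f,c,s,R)$: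 return $c+\theta_*s$, where $\theta_*$ minimises $f(c+\theta s)$ over $\theta\in\{12R,9R,-9R,-12R\}$. *CuttingTrustRegion*$(f,z,\epsilon,L_1,L_3,R)$: put $\alpha=21L_3R^2$, $\hat f(x)=f(x)+\frac\alpha2\|z-x\|^2$, $\hat\epsilon=\epsilon/2$, $\hat L_1=L_1+\alpha$, $N=\lceil\frac d\tau\log^+(16\hat L_1R/\hat\epsilon)\rceil$. Run CuttingPlaneMethod$(\hat f,z,R,N)$ and let $x_{\rm best}$ minimise $\hat f$ over $x^{(0)},\dots,x^{(N)}$. - If $\|\nabla\hat f(x_{\rm best})\|\le\hat\epsilon$, put $u=x_{\rm best}$, $v=\emptyset$, $K=0$. Otherwise let $y=x_{\rm best}-\hat L_1^{-1}\nabla\hat f(x_{\rm best})$ and draw independent uniform points of $B_{\hat\epsilon/(8\hat L_1)}(y)$ until one, $u$, lies outside $S^{(N)}$; $K$ is the number of draws. If $\|u-z\|\le R$, let $v$ be the first $x^{(t)}$ with $\hat f(u)<\hat f(x^{(t)})+\nabla\hat f(x^{(t)})^T(u-x^{(t)})$; otherwise (or if there is no such $t$) $v=\emptyset$. - If $\|\nabla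 f(u)\|\le\epsilon$, compute $p$ minimising $p^T\nabla^2f(u)p$ over $\|p\|=1$ (by a Borel routine); return $u$ if $p^T\nabla^2f(u)p\ge-\alpha$, and ExploitNC$(f,u,p,R)$ otherwise. - If $\|\nabla f(u)\|>\epsilon$, return $u$ if $v=\emptyset$, and ExploitNC$(f,\frac{u+v}2,\frac{v-u}{\|v-u\|},R)$ otherwise. **Time.** $T_p$ ($p=1,2$) is the time for evaluating $f$ and its first $p$ derivatives at a point. Elementary vector and scalar operations and drawing a uniform point of a ball take time at most $cd$; a singular value decomposition takes time at most $cd^\omega$ with $\omega\in[2,3]$; $d\le cT_1$. The time of the procedure includes testing the termination conditions below at every $z^{(t)}$. **Theorem.** For every $\rho>0$ and $c\ge 0$ there is a constant $C>0$, depending only on $\rho$ and $c$, such that the following holds. Let the cutting plane assumption hold, let $f$ have $L_1$-Lipschitz first and $L_3$-Lipschitz third derivatives (that is, for $p=1,3$, $f$ is $C^p$ and $|q^{(p)}(0)-q^{(p)}(\theta)|\le L_p|\theta|$ for every $q(\theta)=f(x+\theta s)$ with $\|s\|\le1$), where $L_1,L_3>0$. Let $\epsilon>0$, let $f$ be bounded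 below and $f(z^{(0)})-\inf f\le\Delta$. Iterate $$z^{(t+1)}\gets\text{CuttingTrustRegion}(f,z^{(t)},\epsilon,L_1,L_3,R),\qquad R=\rho\,L_3^{-1/3}\epsilon^{1/3}.$$ Then there is a positive random variable $\bar K$ with $\mathbf P(\bar K\ge y)\le e^{(1-y)/10}$ for all $y\in\mathbb R$ such that, almost surely, the procedure finds a point $z^{(m)}$ with $$\|\nabla f(z^{(m)})\|\le\epsilon,\qquad \lambda_{\min}(\nabla^2f(z^{(m)}))\ge-21\rho^2L_3^{1/3}\epsilon^{2/3},$$ and the computation time up to the first such $m$ is at most $$C\,\bigl(\Delta L_3^{1/3}\epsilon^{-4/3}+1\bigr)\Bigl(\frac{(T_C+T_1+\bar Kd)\,d}{\tau}\log^+\frac{L_1^3}{\epsilon^2L_3}+T_2+d^\omega\Bigr).$$ In particular, $\rho=1/\sqrt{21}$ gives $\lambda_{\min}\ge-L_3^{1/3}\epsilon^{2/3}$, and $\rho=1/3$ gives $\lambda_{\min}\ge-\frac73L_3^{1/3}\epsilon^{2/3}$. -/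

import Mathlib

open MeasureTheory ProbabilityTheory
open scoped NNReal ENNReal

noncomputable section

namespace CutNC

/-- `ℝᵈ` with the Euclidean norm. -/
abbrev Vec (d : ℕ) : Type := EuclideanSpace ℝ (Fin d)

/-- `log⁺ θ = max {1, log θ}`. -/
def logPlus (θ : ℝ) : ℝ := max 1 (Real.log θ)

/-- `f : ℝᵈ → ℝ` has `L`-Lipschitz `p`-th derivatives: `f` is `C^p`, and along every line
`q θ = f (x + θ s)` with `‖s‖ ≤ 1` one has `|q⁽ᵖ⁾(0) - q⁽ᵖ⁾(θ)| ≤ L |θ|`. -/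
def HasLipschitzDeriv {d : ℕ} (p : ℕ) (L : ℝ) (f : Vec d → ℝ) : Prop :=
  ContDiff ℝ p f ∧ ∀ x s : Vec d, ‖s‖ ≤ 1 → ∀ θ : ℝ,
    |iteratedDeriv p (fun t : ℝ => f (x + t • s)) 0
      - iteratedDeriv p (fun t : ℝ => f (x + t • s)) θ| ≤ L * |θ|

/-- The Hessian `∇²f(x)` as a linear operator. -/
def hessian {d : ℕ} (f : Vec d → ℝ) (x : Vec d) : Vec d →L[ℝ] Vec d :=
  fderiv ℝ (gradient f) x

/-- The minimum eigenvalue (of a symmetric operator). -/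
def lamMin {d : ℕ} (A : Vec d →L[ℝ] Vec d) : ℝ :=
  sInf {μ : ℝ | Module.End.HasEigenvalue (A : Vec d →ₗ[ℝ] Vec d) μ}

/-! ### Timed computations -/

/-- A result together with the time spent on computing it (`⊤` if the computation diverges). -/
structure Timed (α : Type) where
  val : α
  time : ℝ≥0∞

/-- Sequential composition adds the times. -/
instance : Monad Timed where
  pure a := ⟨a, 0⟩
  bind x k := ⟨(k x.val).val, x.time + (k x.val).time⟩

/-- Compute the value `a` at price `t`. -/
def charge {α : Type} (t : ℝ≥0) (a : α) : Timed α := ⟨a, (t : ℝ≥0∞)⟩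

/-- The prices of the primitive operations in dimension `d`.
* `T1`, `T2`: evaluating `f` with its first, respectively first two, derivatives at a point;
* `TC`: one call of the centre routine;
* `c * d`: one elementary operation on vectors (sum, scalar multiple, inner product, norm,
  drawing a uniform point of a ball) or on scalars;
* `c * d ^ ω`: a singular value decomposition of a `d × d` matrix (or another operation that is
  at most as expensive, such as applying a matrix to a vector). -/
structure Prices where
  c : ℝ≥0
  ω : ℝ
  T1 : ℝ≥0
  T2 : ℝ≥0
  TC : ℝ≥0

/-- The price of an elementary vector operation. -/
def Prices.vec (P : Prices) (d : ℕ) : ℝ≥0 := P.c * d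

/-- The price of a singular value decomposition. -/
def Prices.svd (P : Prices) (d : ℕ) : ℝ≥0 := P.c * (d : ℝ≥0) ^ P.ω

/-! ### The cutting plane method -/

/-- What is known about a function at a queried point. -/
structure Query (d : ℕ) where
  point : Vec d
  value : ℝ
  slope : Vec d

/-- Evaluate `g` and `∇g` at `x`, where `g` is `f` plus a multiple of a squared distance: one
evaluation of `f` and `∇f`, and a few vector operations for the additional term. -/
def query {d : ℕ} (P : Prices) (g : Vec d → ℝ) (x : Vec d) : Timed (Query d) :=
  charge (P.T1 + 5 * P.vec d) ⟨x, g x, gradient g x⟩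

open Classical in
/-- The normal of the cut produced by a query: the gradient or, should it vanish, the fixed
direction `e`. -/
def cutNormal {d : ℕ} (e : Vec d) (q : Query d) : Vec d := if q.slope = 0 then e else q.slope

/-- The half-space through the queried point kept by the cut. -/
def cut {d : ℕ} (e : Vec d) (q : Query d) : Set (Vec d) :=
  {x | inner ℝ (cutNormal e q) (x - q.point) ≤ 0}

/-- `CuttingPlaneMethod`: returns the region `S⁽ᴺ⁾` and the queries at `x⁽⁰⁾, …, x⁽ᴺ⁾`. -/
def cuttingPlaneMethod {d : ℕ} (P : Prices) (centre : Set (Vec d) → Vec d) (e : Vec d)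
    (g : Vec d → ℝ) (x₀ : Vec d) (R : ℝ) :
    (N : ℕ) → Timed (Set (Vec d) × (Fin (N + 1) → Query d))
  | 0 => do
      let q ← query P g x₀
      return (Metric.closedBall x₀ R ∩ cut e q, fun _ => q)
  | N + 1 => do
      let (S, qs) ← cuttingPlaneMethod P centre e g x₀ R N
      let x ← charge P.TC (centre S)
      let q ← query P g x
      return (S ∩ cut e q, Fin.snoc (α := fun _ => Query d) qs q)

/-- The part of the ball of radius `R` about `z` that satisfies the linear inequalities
`⟨g, y - x⟩ ≤ 0` for the listed pairs `(x, g)`. -/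
def region {d n : ℕ} (z : Vec d) (R : ℝ) (cuts : Fin n → Vec d × Vec d) : Set (Vec d) :=
  Metric.closedBall z R ∩ {y | ∀ i, inner ℝ (cuts i).2 (y - (cuts i).1) ≤ 0}

/-- The assumption on the centre routine: it picks a point of the region it is given, as a Borel
function of the data describing the region, and after `N` steps the cutting plane method has
reduced the volume to at most `(1 - τ)ᴺ` times that of the initial ball. -/
structure CuttingPlaneAssumption {d : ℕ} (P : Prices) (centre : Set (Vec d) → Vec d)
    (e : Vec d) (τ : ℝ) : Prop where
  tau_pos : 0 < τ
  tau_le : τ ≤ 1 / 2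
  centre_mem : ∀ S : Set (Vec d), S.Nonempty → IsCompact S → Convex ℝ S → centre S ∈ S
  measurable_centre : ∀ (n : ℕ) (R : ℝ),
    Measurable fun p : Vec d × (Fin n → Vec d × Vec d) => centre (region p.1 R p.2)
  volume_le : ∀ (g : Vec d → ℝ) (x₀ : Vec d) (R : ℝ) (N : ℕ), Differentiable ℝ g → 0 < R →
    0 < N → volume (cuttingPlaneMethod P centre e g x₀ R N).val.1 ≤
      ENNReal.ofReal ((1 - τ) ^ N) * volume (Metric.closedBall (0 : Vec d) R)

/-! ### Certificates of nonconvexity and how to exploit them -/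

open Classical in
/-- Go through the random points `u 0, u 1, …` up to the first one outside `S`; every trial has
the same price. Returns that point and the number `K` of trials. -/
def rejectionLoop {d : ℕ} (price : ℝ≥0) (u : ℕ → Vec d) (S : Set (Vec d)) :
    Timed (Vec d × ℕ) :=
  if h : ∃ k, u k ∉ S then
    ⟨(u (Nat.find h), Nat.find h + 1), ((Nat.find h + 1 : ℕ) : ℝ≥0∞) * (price : ℝ≥0∞)⟩
  else ⟨(u 0, 0), ⊤⟩

open Classical in
/-- `NonconvexityCertificate`: returns `u`, `v` (where `none` stands for `∅`) and `K`.
`ξ` lists the random points of the unit ball, so that `y + r ξ` are points of `B_r(y)`. -/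
def nonconvexityCertificate {d N : ℕ} (P : Prices) (g : Vec d → ℝ) (S : Set (Vec d))
    (x₀ : Vec d) (qs : Fin (N + 1) → Query d) (L ε R : ℝ) (ξ : ℕ → Vec d) :
    Timed (Vec d × Option (Vec d) × ℕ) := do
  let best ← charge ((N + 2) * P.vec d)
    (qs (((List.finRange (N + 1)).argmin fun i => (qs i).value).getD 0))
  if ‖best.slope‖ ≤ ε then
    return (best.point, none, 0)
  else
    let y ← charge (3 * P.vec d) (best.point - (1 / L) • best.slope)
    let r := ε / (8 * L)
    -- a trial: draw `u`, test the ball constraint and the `N + 1` cuts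
    let (u, K) ← rejectionLoop ((3 + 2 + 2 * (N + 1)) * P.vec d) (fun k => y + r • ξ k) S
    let inBall ← charge (2 * P.vec d) (decide (‖u - x₀‖ ≤ R))
    if inBall then
      let qu ← query P g u
      let t ← charge (4 * (N + 1) * P.vec d) ((List.finRange (N + 1)).find? fun i =>
        decide (qu.value < (qs i).value + inner ℝ (qs i).slope (u - (qs i).point)))
      return (u, t.map fun i => (qs i).point, K)
    else
      return (u, none, K)

/-- `ExploitNC`: the best of the points `c ± 9 R s`, `c ± 12 R s`. -/
def exploitNC {d : ℕ} (P : Prices) (f : Vec d → ℝ) (c s : Vec d) (R : ℝ) : Timed (Vec d) :=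
  charge (4 * (P.T1 + 3 * P.vec d) + 2 * P.vec d)
    (c + (([12 * R, 9 * R, -9 * R, -12 * R].argmin fun θ => f (c + θ • s)).getD 0) • s)

/-- A routine that returns, for a symmetric operator, a minimiser of `sᵀ A s` over the unit
sphere, as a Borel function of `A`. -/
structure IsMinDirection {d : ℕ} (eig : (Vec d →L[ℝ] Vec d) → Vec d) : Prop where
  measurable : Measurable eig
  norm_eq : ∀ A, ‖eig A‖ = 1
  le : ∀ A : Vec d →L[ℝ] Vec d, (A : Vec d →ₗ[ℝ] Vec d).IsSymmetric →
    ∀ s : Vec d, ‖s‖ = 1 → inner ℝ (eig A) (A (eig A)) ≤ inner ℝ s (A s)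

/-- The number of cutting plane steps: `(d/τ) log⁺ (16 L R / ε)`, rounded up. -/
def numSteps (d : ℕ) (τ L R ε : ℝ) : ℕ := ⌈(d / τ) * logPlus (16 * L * R / ε)⌉₊

open Classical in
/-- `CuttingTrustRegion`: returns `z⁺` and `K`. -/
def cuttingTrustRegion {d : ℕ} (P : Prices) (centre : Set (Vec d) → Vec d) (e : Vec d) (τ : ℝ)
    (eig : (Vec d →L[ℝ] Vec d) → Vec d) (f : Vec d → ℝ) (z : Vec d) (ε L₁ L₃ R : ℝ)
    (ξ : ℕ → Vec d) : Timed (Vec d × ℕ) := do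
  let α := 21 * L₃ * R ^ 2
  let fhat : Vec d → ℝ := fun x => f x + α / 2 * ‖z - x‖ ^ 2
  let εhat := ε / 2
  let Lhat := L₁ + α
  let N ← charge (P.vec d) (numSteps d τ Lhat R εhat)
  let (S, qs) ← cuttingPlaneMethod P centre e fhat z R N
  let (u, v, K) ← nonconvexityCertificate P fhat S z qs Lhat εhat R ξ
  let gu ← charge (P.T1 + P.vec d) (gradient f u)
  if ‖gu‖ ≤ ε then
    let H ← charge P.T2 (hessian f u)
    let p ← charge (P.svd d) (eig H)
    let curv ← charge (P.svd d + P.vec d) (inner ℝ p (H p))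
    if -α ≤ curv then
      return (u, K)
    else
      let zplus ← exploitNC P f u p R
      return (zplus, K)
  else
    match v with
    | none => return (u, K)
    | some v =>
      let mid ← charge (2 * P.vec d) ((1 / 2 : ℝ) • (u + v))
      let s ← charge (3 * P.vec d) ((1 / ‖v - u‖) • (v - u))
      let zplus ← exploitNC P f mid s R
      return (zplus, K)

/-- The termination conditions `‖∇f(z)‖ ≤ ε` and `λ_min(∇²f(z)) ≥ -η`. -/
def IsApproxStationary {d : ℕ} (f : Vec d → ℝ) (ε η : ℝ) (z : Vec d) : Prop :=
  ‖gradient f z‖ ≤ ε ∧ -η ≤ lamMin (hessian f z)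

/-- The first `n` calls `z⁽ᵗ⁺¹⁾ ← CuttingTrustRegion(f, z⁽ᵗ⁾, ε, L₁, L₃, R)`, including the price
of testing the termination conditions at each of `z⁽⁰⁾, …, z⁽ⁿ⁾`. The call number `t` draws its
random points from `ξ t`. -/
def repeatedCalls {d : ℕ} (P : Prices) (centre : Set (Vec d) → Vec d) (e : Vec d) (τ : ℝ)
    (eig : (Vec d →L[ℝ] Vec d) → Vec d) (f : Vec d → ℝ) (z₀ : Vec d) (ε L₁ L₃ R : ℝ)
    (ξ : ℕ → ℕ → Vec d) : ℕ → Timed (Vec d)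
  | 0 => charge (P.T2 + P.svd d + 2 * P.vec d) z₀
  | n + 1 => do
      let z ← repeatedCalls P centre e τ eig f z₀ ε L₁ L₃ R ξ n
      let (zplus, _) ← cuttingTrustRegion P centre e τ eig f z ε L₁ L₃ R (ξ n)
      charge (P.T2 + P.svd d + 2 * P.vec d) zplus

end CutNC

end

namespace CutNC

/-! ### Taylor estimates on the line -/

/-! A call either ends at an approximate stationary point or lowers `f` by a fixed multiple of
`L₃^(-1/3) ε^(4/3)`. Since `f` is bounded below, this limits the number of calls; what remains is to
control the random price of the calls.

Progress (`Setup.Valid.next_progress`). With `α = 21 L₃ R²`, the point `u` of the certificate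
satisfies `f u + α/2 ‖u - z‖² ≤ f z`. Suppose that `∇f(u)` is large. If the model gradient at `u` is
small, or if `u` has left the ball, then `u` is far from `z` and the penalty alone gives the
decrease. Otherwise `u` is a perturbed gradient step whose model value is below that of every query,
yet it lies in the ball and outside the kept region. So it violates a cut at some query `v`, and the
tangent of the model at `v` lies above the model at `u`.

Such a pair is exploited on the line through `u` and `v` (`exists_decrease_of_tangent`). Put the
midpoint at `0`, with `u` at `-h` and `v` at `h`, and let `c`, `k` be the second and third
derivatives at `0`. The violated tangent forces `c + k h / 3 ≤ -20 L₃ R²`. There are probability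
weights on `±9R`, `±12R` with mean `-h` whose third moment makes the average of the cubic Taylor
polynomial differ from its value at `-h` by exactly `(112.5 R² - h²)/2 * (c + k h / 3)`. The unknown
first and third derivatives thus do no harm, and the Lipschitz third derivative pays for the
remainder. If instead `∇f(u)` is small but the curvature at `u` is too negative, averaging over
`±12R` suffices.

Randomness. The kept region has at most half the volume of the ball from which candidates are drawn,
so each draw is rejected with probability at most `1/2`, whatever the past. Hence `wait`, a majorant
of the exponential of a tenth of the number of draws in a call, has conditional mean at most `4`,
and the product over `n` calls has mean at most `4 ^ n` (`Setup.Valid.lintegral_waits_le`). Markov's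
inequality for this product yields one variable that bounds all draws of the run
(`Setup.Valid.exists_trials_bound`). -/

theorem abs_le_of_abs_deriv_le {g g' : ℝ → ℝ} {M : ℝ} {n : ℕ}
    (hg : ∀ θ, HasDerivAt g (g' θ) θ) (h0 : g 0 = 0) (hb : ∀ θ, |g' θ| ≤ M * |θ| ^ n) (θ : ℝ) :
    |g θ| ≤ M * |θ| ^ (n + 1) / (n + 1) := by
  have key : ∀ {g g' : ℝ → ℝ}, (∀ θ, HasDerivAt g (g' θ) θ) → g 0 = 0 →
      (∀ θ, |g' θ| ≤ M * |θ| ^ n) → ∀ θ, 0 ≤ θ → |g θ| ≤ M * θ ^ (n + 1) / (n + 1) := by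
    intro g g' hg h0 hb θ hθ
    have hB : ∀ x : ℝ, HasDerivAt (fun x : ℝ => M * x ^ (n + 1) / (n + 1)) (M * x ^ n) x := by
      intro x
      have h := ((hasDerivAt_pow (n + 1) x).const_mul M).div_const ((n : ℝ) + 1)
      refine h.congr_deriv ?_
      have : (n : ℝ) + 1 ≠ 0 := by positivity
      push_cast
      field_simp
    refine image_norm_le_of_norm_deriv_right_le_deriv_boundary (f := g) (a := 0) (b := θ)
      (f' := g') (fun x _ => (hg x).continuousAt.continuousWithinAt)
      (fun x _ => (hg x).hasDerivWithinAt) (by simp [h0]) hB ?_ ⟨hθ, le_rfl⟩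
    intro x hx
    have := hb x
    rwa [abs_of_nonneg hx.1] at this
  rcases le_total 0 θ with hθ | hθ
  · rw [abs_of_nonneg hθ]
    exact key hg h0 hb θ hθ
  · rw [abs_of_nonpos hθ]
    have h := key (g := fun x => g (-x)) (g' := fun x => -g' (-x)) (fun x => by
      have := (hg (-x)).scomp x (hasDerivAt_neg x)
      simpa using! this) (by simpa using h0)
      (fun x => by simpa using hb (-x)) (-θ) (by linarith)
    simpa using h

theorem hasDerivAt_iteratedDeriv {q : ℝ → ℝ} {n k : ℕ} (hq : ContDiff ℝ n q) (hk : k < n)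
    (x : ℝ) : HasDerivAt (iteratedDeriv k q) (iteratedDeriv (k + 1) q x) x := by
  rw [iteratedDeriv_succ]
  exact ((hq.differentiable_iteratedDeriv k (by exact_mod_cast hk)) x).hasDerivAt

theorem taylor_one {q : ℝ → ℝ} {L : ℝ} (hq : ContDiff ℝ 1 q)
    (hL : ∀ θ, |iteratedDeriv 1 q 0 - iteratedDeriv 1 q θ| ≤ L * |θ|) (θ : ℝ) :
    |q θ - (q 0 + iteratedDeriv 1 q 0 * θ)| ≤ L * |θ| ^ 2 / 2 := by
  have h := abs_le_of_abs_deriv_le (M := L) (n := 1)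
    (g := fun θ => q θ - (q 0 + iteratedDeriv 1 q 0 * θ))
    (g' := fun θ => iteratedDeriv 1 q θ - iteratedDeriv 1 q 0)
    (fun x => by
      have h1 := hasDerivAt_iteratedDeriv (n := 1) (k := 0) hq (by norm_num) x
      rw [iteratedDeriv_zero] at h1
      have h2 := h1.sub (((hasDerivAt_id x).const_mul (iteratedDeriv 1 q 0)).const_add (q 0))
      simpa using! h2) (by simp)
    (fun θ => by rw [abs_sub_comm]; simpa using hL θ) θ
  convert h using 1
  norm_num

/-- Integrate the bound on the third derivative three times from `0`. Only comparisons with `0` are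
assumed, so every expansion is about `0`. -/
theorem taylor_three {q : ℝ → ℝ} {L : ℝ} (hq : ContDiff ℝ 3 q)
    (hL : ∀ θ, |iteratedDeriv 3 q 0 - iteratedDeriv 3 q θ| ≤ L * |θ|) (θ : ℝ) :
    |deriv q θ - (deriv q 0 + iteratedDeriv 2 q 0 * θ + iteratedDeriv 3 q 0 * θ ^ 2 / 2)|
        ≤ L * |θ| ^ 3 / 6 ∧
      |q θ - (q 0 + deriv q 0 * θ + iteratedDeriv 2 q 0 * θ ^ 2 / 2
        + iteratedDeriv 3 q 0 * θ ^ 3 / 6)| ≤ L * |θ| ^ 4 / 24 := by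
  rw [← iteratedDeriv_one]
  set b := iteratedDeriv 1 q 0
  set c := iteratedDeriv 2 q 0
  set k := iteratedDeriv 3 q 0
  have hd : ∀ j, j < 3 → ∀ x, HasDerivAt (iteratedDeriv j q) (iteratedDeriv (j + 1) q x) x :=
    fun j hj x => hasDerivAt_iteratedDeriv (n := 3) hq hj x
  have hp : ∀ n x : ℝ, HasDerivAt (fun θ : ℝ => n * θ) n x := fun n x => by
    simpa using (hasDerivAt_id x).const_mul n
  have hp2 : ∀ n x : ℝ, HasDerivAt (fun θ : ℝ => n * θ ^ 2 / 2) (n * x) x := fun n x => by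
    refine (((hasDerivAt_pow 2 x).const_mul n).div_const 2).congr_deriv ?_
    push_cast; ring
  have hp3 : ∀ n x : ℝ, HasDerivAt (fun θ : ℝ => n * θ ^ 3 / 6) (n * x ^ 2 / 2) x := fun n x => by
    refine (((hasDerivAt_pow 3 x).const_mul n).div_const 6).congr_deriv ?_
    push_cast; ring
  have h2 : ∀ θ, |iteratedDeriv 2 q θ - (c + k * θ)| ≤ L * |θ| ^ 2 / 2 := fun θ => by
    have h := abs_le_of_abs_deriv_le (M := L) (n := 1)
      (g := fun θ => iteratedDeriv 2 q θ - (c + k * θ)) (g' := fun θ => iteratedDeriv 3 q θ - k)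
      (fun x => (hd 2 (by norm_num) x).sub ((hp k x).const_add c)) (by simp [c])
      (fun θ => by rw [abs_sub_comm]; simpa using hL θ) θ
    convert h using 1
    norm_num
  have h1 : ∀ θ, |iteratedDeriv 1 q θ - (b + c * θ + k * θ ^ 2 / 2)| ≤ L * |θ| ^ 3 / 6 := fun θ => by
    have h := abs_le_of_abs_deriv_le (M := L / 2) (n := 2)
      (g := fun θ => iteratedDeriv 1 q θ - (b + c * θ + k * θ ^ 2 / 2))
      (g' := fun θ => iteratedDeriv 2 q θ - (c + k * θ))
      (fun x => (hd 1 (by norm_num) x).sub (((hp c x).const_add b).add (hp2 k x))) (by simp [b])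
      (fun θ => by convert h2 θ using 1; ring) θ
    convert h using 1
    push_cast; ring
  refine ⟨h1 θ, ?_⟩
  have h := abs_le_of_abs_deriv_le (M := L / 6) (n := 3)
    (g := fun θ => q θ - (q 0 + b * θ + c * θ ^ 2 / 2 + k * θ ^ 3 / 6))
    (g' := fun θ => iteratedDeriv 1 q θ - (b + c * θ + k * θ ^ 2 / 2))
    (fun x => by
      have h0 := hd 0 (by norm_num) x
      rw [iteratedDeriv_zero] at h0
      exact h0.sub ((((hp b x).const_add (q 0)).add (hp2 c x)).add (hp3 k x))) (by simp)
    (fun θ => by convert h1 θ using 1; ring) θ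
  convert h using 1
  push_cast; ring

/-- Negative curvature at a point leads to a decrease at one of four points. -/
theorem exists_decrease_of_curvature {q : ℝ → ℝ} {L R : ℝ} (hR : 0 < R)
    (hq : ContDiff ℝ 3 q)
    (hL : ∀ θ, |iteratedDeriv 3 q 0 - iteratedDeriv 3 q θ| ≤ L * |θ|)
    (hc : iteratedDeriv 2 q 0 < -(21 * L * R ^ 2)) :
    ∃ θ ∈ [12 * R, 9 * R, -9 * R, -12 * R], q θ ≤ q 0 - 500 * L * R ^ 4 := by
  have hL0 : 0 ≤ L := by simpa using (abs_nonneg _).trans (hL 1)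
  have h1 := (abs_le.1 (taylor_three hq hL (12 * R)).2).2
  have h2 := (abs_le.1 (taylor_three hq hL (-12 * R)).2).2
  rw [abs_of_pos (by linarith)] at h1
  rw [abs_of_neg (by linarith)] at h2
  by_contra! h
  have h3 := h (12 * R) (by simp)
  have h4 := h (-12 * R) (by simp)
  -- In the average over `±12R` the odd terms cancel. In units of `L R⁴` the curvature gives less
  -- than `-72 * 21 = -1512` and the remainder at most `12⁴/24 = 864`, which leaves `-648`.
  have h5 := mul_lt_mul_of_pos_left hc (show 0 < 144 * R ^ 2 by positivity)
  have h6 : 0 ≤ L * R ^ 4 := by positivity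
  nlinarith

/-- The weights `(1/2 ± y)/2` at `±12` and `(1/2 ± v)/2` at `±9` have total mass `1` and second
moment `112.5` for all `y`, `v`; the two equations prescribe the first and the third moment. The
bounds on `y`, `v` make the weights nonnegative. -/
theorem exists_weights {x : ℝ} (hx0 : 0 < x) (hx1 : x ≤ 1) :
    ∃ y v : ℝ, -(1 / 2) ≤ y ∧ y ≤ 1 / 2 ∧ -(1 / 2) ≤ v ∧ v ≤ 1 / 2 ∧ 12 * y + 9 * v = -x ∧
      1728 * y + 729 * v = x * 112.5 - 2 * x ^ 3 := by
  have hx3 : 0 ≤ x ^ 3 := by positivity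
  have hx3' : x ^ 3 ≤ x := by
    simpa using pow_le_pow_of_le_one hx0.le hx1 (show 1 ≤ 3 by norm_num)
  -- Subtracting `81` times the first equation from the second eliminates `v` and leaves `756 y =
  -- 193.5 x - 2 x³`.
  refine ⟨x * (193.5 - 2 * x ^ 2) / 756, (-x - 12 * (x * (193.5 - 2 * x ^ 2) / 756)) / 9,
    ?_, ?_, ?_, ?_, ?_, ?_⟩
  iterate 4 linarith
  all_goals ring

/-- A violated tangent inequality leads to a decrease at one of four points. -/
theorem exists_decrease_of_tangent {q : ℝ → ℝ} {L R h : ℝ} (hLpos : 0 < L) (h0 : 0 < h)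
    (hR : h ≤ R) (hq : ContDiff ℝ 3 q)
    (hL : ∀ θ, |iteratedDeriv 3 q 0 - iteratedDeriv 3 q θ| ≤ L * |θ|)
    (hc : q (-h) < q h - 2 * h * deriv q h - 2 * (21 * L * R ^ 2) * h ^ 2) :
    ∃ θ ∈ [12 * R, 9 * R, -9 * R, -12 * R], q θ ≤ q (-h) - 500 * L * R ^ 4 := by
  have hR0 : 0 < R := h0.trans_le hR
  set b := deriv q 0 with hb
  set c := iteratedDeriv 2 q 0 with hc'
  set k := iteratedDeriv 3 q 0 with hk
  have T := taylor_three hq hL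
  simp only [← hb, ← hc', ← hk] at T
  have e1 := (abs_le.1 (T h).2).2
  have e2 := (abs_le.1 (T (-h)).2).1
  have e3 := (abs_le.1 (T h).1).1
  rw [abs_of_pos h0] at e1 e3
  rw [abs_of_neg (by linarith)] at e2
  -- With the Taylor bounds inserted in `hc`, `q 0` and `b` cancel. The remainders cost `5/24 * L
  -- h²`, for which one of the `21` units is given up.
  have hcurv : c + k * h / 3 ≤ -(20 * L * R ^ 2) := by
    have hh : h ^ 2 ≤ R ^ 2 := by gcongr
    have e4 := mul_le_mul_of_nonneg_left e3 (show 0 ≤ 2 * h by positivity)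
    have e5 : 2 * h ^ 2 * (c + k * h / 3) ≤ 2 * h ^ 2 * (-(21 * L * R ^ 2) + 5 / 24 * L * h ^ 2) := by
      nlinarith
    have e6 := le_of_mul_le_mul_left e5 (by positivity)
    have e7 : L * h ^ 2 ≤ L * R ^ 2 := by gcongr
    have e8 : 0 ≤ L * R ^ 2 := by positivity
    nlinarith
  have f1 := (abs_le.1 (T (12 * R)).2).2
  have f2 := (abs_le.1 (T (9 * R)).2).2
  have f3 := (abs_le.1 (T (-9 * R)).2).2
  have f4 := (abs_le.1 (T (-12 * R)).2).2
  rw [abs_of_pos (by linarith)] at f1 f2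
  rw [abs_of_neg (by linarith)] at f3 f4
  by_contra! H
  have g1 := H (12 * R) (by simp)
  have g2 := H (9 * R) (by simp)
  have g3 := H (-9 * R) (by simp)
  have g4 := H (-12 * R) (by simp)
  clear H T hL hq hc e1 e3
  -- scale to `R = 1`
  obtain ⟨x, rfl⟩ : ∃ x, h = x * R := ⟨h / R, by field_simp⟩
  have hx0 : 0 < x := by
    by_contra! hx
    nlinarith
  have hx1 : x ≤ 1 := by
    by_contra! hx
    nlinarith
  obtain ⟨y, v, hy1, hy2, hv1, hv2, i1, i3⟩ := exists_weights hx0 hx1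
  set B := q (-(x * R)) with hB
  -- The upper bounds `f1`–`f4` and the contrary assumptions `g1`–`g4` are averaged with the same
  -- four weights.
  have w1 := mul_le_mul_of_nonneg_left f1 (show 0 ≤ (1 / 2 + y) / 2 by linarith)
  have w2 := mul_le_mul_of_nonneg_left f2 (show 0 ≤ (1 / 2 + v) / 2 by linarith)
  have w3 := mul_le_mul_of_nonneg_left f3 (show 0 ≤ (1 / 2 - v) / 2 by linarith)
  have w4 := mul_le_mul_of_nonneg_left f4 (show 0 ≤ (1 / 2 - y) / 2 by linarith)
  have z1 := mul_le_mul_of_nonneg_left g1.le (show 0 ≤ (1 / 2 + y) / 2 by linarith)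
  have z2 := mul_le_mul_of_nonneg_left g2.le (show 0 ≤ (1 / 2 + v) / 2 by linarith)
  have z3 := mul_le_mul_of_nonneg_left g3.le (show 0 ≤ (1 / 2 - v) / 2 by linarith)
  have z4 := mul_le_mul_of_nonneg_left g4.le (show 0 ≤ (1 / 2 - y) / 2 by linarith)
  -- Second order contributes `(112.5 - x²) R² c / 2`, and third order `(112.5 x - x³) R³ k / 6`.
  -- The second is the first with `c` replaced by `k h / 3`, so `hcurv` controls their sum.
  have hA := mul_le_mul_of_nonneg_left hcurv
    (show 0 ≤ R ^ 2 * (112.5 - x ^ 2) / 2 by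
      have : x ^ 2 ≤ 1 := pow_le_one₀ hx0.le hx1
      have : 0 ≤ R ^ 2 := by positivity
      have : 0 ≤ (112.5 - x ^ 2) := by linarith
      positivity)
  have hx2 : x ^ 2 ≤ 1 := pow_le_one₀ hx0.le hx1
  have hx4 : x ^ 4 ≤ 1 := pow_le_one₀ hx0.le hx1
  have hM : 0 < L * R ^ 4 := by positivity
  have hM2 : L * R ^ 4 * x ^ 4 ≤ L * R ^ 4 * 1 := by gcongr
  have hM3 : L * R ^ 4 * x ^ 2 ≤ L * R ^ 4 * 1 := by gcongr
  have j1 : b * R * (12 * y + 9 * v) = b * R * -x := by rw [i1]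
  have j3 : k * R ^ 3 * (1728 * y + 729 * v) = k * R ^ 3 * (x * 112.5 - 2 * x ^ 3) := by rw [i3]
  clear_value B
  clear i1 i3 hB f1 f2 f3 f4 g1 g2 g3 g4 hcurv
  -- In units of `L R⁴`: the curvature gives at most `-20 * 111.5 / 2 = -1115`, the remainders at
  -- most `(12⁴ + 9⁴)/48 + 1/24 < 569`, so the average is more than `500` below `B`.
  linarith

/-! ### Restrictions to lines, the regularised model -/

section Calculus

variable {d : ℕ} {f : Vec d → ℝ}

theorem contDiff_line {n : WithTop ℕ∞} (hf : ContDiff ℝ n f) (x s : Vec d) :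
    ContDiff ℝ n fun t : ℝ => f (x + t • s) :=
  hf.comp (by fun_prop)

theorem deriv_line (hf : Differentiable ℝ f) (x s : Vec d) (t : ℝ) :
    deriv (fun t : ℝ => f (x + t • s)) t = inner ℝ (gradient f (x + t • s)) s := by
  have h1 : HasDerivAt (fun t : ℝ => x + t • s) s t := by
    simpa using ((hasDerivAt_id t).smul_const s).const_add x
  have h2 := (hf (x + t • s)).hasGradientAt.hasFDerivAt.comp_hasDerivAt t h1
  simpa using! h2.deriv

theorem contDiff_gradient (hf : ContDiff ℝ 2 f) : ContDiff ℝ 1 (gradient f) := by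
  have : ContDiff ℝ 1 (fderiv ℝ f) := hf.fderiv_right (by norm_num)
  exact (InnerProductSpace.toDual ℝ (Vec d)).symm.contDiff.comp this

theorem continuous_hessian (hf : ContDiff ℝ 2 f) : Continuous (hessian f) :=
  (contDiff_gradient hf).continuous_fderiv (by norm_num)

theorem iteratedDeriv_two_line (hf : ContDiff ℝ 2 f) (x s : Vec d) :
    iteratedDeriv 2 (fun t : ℝ => f (x + t • s)) 0 = inner ℝ s (hessian f x s) := by
  rw [iteratedDeriv_succ, iteratedDeriv_one, funext (deriv_line (hf.differentiable (by norm_num)) x s)]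
  have h1 : HasDerivAt (fun t : ℝ => x + t • s) s 0 := by
    simpa using ((hasDerivAt_id (0 : ℝ)).smul_const s).const_add x
  have h3 : HasFDerivAt (gradient f) (hessian f x) (x + (0 : ℝ) • s) := by
    simpa using! ((contDiff_gradient hf).differentiable (by norm_num) x).hasFDerivAt
  have h2 := (h3.comp_hasDerivAt (0 : ℝ) h1).inner ℝ (hasDerivAt_const (0 : ℝ) s)
  have h4 := h2.deriv
  simp only [Function.comp_def] at h4
  rw [h4]
  simp [real_inner_comm]

theorem inner_hessian (hf : ContDiff ℝ 2 f) (x v w : Vec d) :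
    inner ℝ (hessian f x v) w = fderiv ℝ (fderiv ℝ f) x v w := by
  have h : gradient f = fun y => (InnerProductSpace.toDual ℝ (Vec d)).symm (fderiv ℝ f y) := rfl
  have hd : DifferentiableAt ℝ (fderiv ℝ f) x :=
    (hf.fderiv_right (m := 1) (by norm_num)).differentiable (by norm_num) x
  have h2 : HasFDerivAt (gradient f) _ x :=
    ((InnerProductSpace.toDual ℝ (Vec d)).symm.toContinuousLinearEquiv.toContinuousLinearMap.hasFDerivAt.comp x
      hd.hasFDerivAt)
  rw [hessian, h2.fderiv]
  simp

theorem hessian_isSymmetric (hf : ContDiff ℝ 2 f) (x : Vec d) :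
    (hessian f x : Vec d →ₗ[ℝ] Vec d).IsSymmetric := by
  intro v w
  have hs : IsSymmSndFDerivAt ℝ f x := hf.contDiffAt.isSymmSndFDerivAt (by simp)
  change inner ℝ (hessian f x v) w = inner ℝ v (hessian f x w)
  rw [real_inner_comm (hessian f x w) v, inner_hessian hf, inner_hessian hf, hs v w]

/-- Apply the bound to normalised eigenvectors. The condition `a ≤ 0` covers an empty set of
eigenvalues, whose `sInf` is `0`. -/
theorem le_lamMin {A : Vec d →L[ℝ] Vec d} {a : ℝ} (ha : a ≤ 0)
    (h : ∀ s : Vec d, ‖s‖ = 1 → a ≤ inner ℝ s (A s)) : a ≤ lamMin A := by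
  refine Real.le_sInf (fun μ hμ => ?_) ha
  obtain ⟨v, hv⟩ := Module.End.HasEigenvalue.exists_hasEigenvector hμ
  have hv0 : ‖v‖ ≠ 0 := norm_ne_zero_iff.2 hv.2
  have h1 := h ((‖v‖)⁻¹ • v) (by simp [norm_smul, hv0])
  have h2 : A v = μ • v := hv.apply_eq_smul
  rw [map_smul, h2, real_inner_smul_left, real_inner_smul_right, real_inner_smul_right,
    real_inner_self_eq_norm_sq] at h1
  convert h1 using 1
  field_simp

/-- The descent inequality. -/
theorem HasLipschitzDeriv.le_add {L : ℝ} (hf : HasLipschitzDeriv 1 L f) (x h : Vec d) :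
    f (x + h) ≤ f x + inner ℝ (gradient f x) h + L / 2 * ‖h‖ ^ 2 := by
  rcases eq_or_ne h 0 with rfl | hh
  · simp
  have hn : ‖h‖ ≠ 0 := norm_ne_zero_iff.2 hh
  have hf1 : ContDiff ℝ 1 f := hf.1
  have hs : ‖(‖h‖)⁻¹ • h‖ = 1 := by simp [norm_smul, hn]
  have h1 := taylor_one (contDiff_line hf1 x ((‖h‖)⁻¹ • h)) (hf.2 x _ hs.le) ‖h‖
  rw [iteratedDeriv_one, deriv_line (hf1.differentiable (by norm_num)), abs_norm] at h1
  simp only [zero_smul, add_zero, smul_inv_smul₀ hn, real_inner_smul_right] at h1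
  have h2 := (abs_le.1 h1).2
  have h3 : (‖h‖)⁻¹ * inner ℝ (gradient f x) h * ‖h‖ = inner ℝ (gradient f x) h := by
    field_simp
  rw [h3] at h2
  linarith

/-- The objective plus a quadratic penalty. -/
noncomputable def model (f : Vec d → ℝ) (α : ℝ) (z x : Vec d) : ℝ := f x + α / 2 * ‖z - x‖ ^ 2

theorem hasGradientAt_model (hf : Differentiable ℝ f) (α : ℝ) (z x : Vec d) :
    HasGradientAt (model f α z) (gradient f x + α • (x - z)) x := by
  rw [hasGradientAt_iff_hasFDerivAt]
  have h1 := (hf x).hasGradientAt.hasFDerivAt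
  have h2 : HasFDerivAt (fun x => ‖z - x‖ ^ 2) _ x := ((hasFDerivAt_id x).const_sub z).norm_sq
  refine (h1.add (h2.const_mul (α / 2))).congr_fderiv ?_
  ext v
  simp
  ring

theorem gradient_model (hf : Differentiable ℝ f) (α : ℝ) (z x : Vec d) :
    gradient (model f α z) x = gradient f x + α • (x - z) :=
  (hasGradientAt_model hf α z x).gradient

theorem differentiable_model (hf : Differentiable ℝ f) (α : ℝ) (z : Vec d) :
    Differentiable ℝ (model f α z) := fun x => (hasGradientAt_model hf α z x).differentiableAt

theorem norm_sub_add_sq (z x h : Vec d) :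
    ‖z - (x + h)‖ ^ 2 = ‖z - x‖ ^ 2 + 2 * inner ℝ (x - z) h + ‖h‖ ^ 2 := by
  have : z - (x + h) = -((x - z) + h) := by abel
  rw [this, norm_neg, norm_add_sq_real, norm_sub_rev x z]

theorem model_add_le {L α : ℝ} (hf : HasLipschitzDeriv 1 L f) (z x h : Vec d) :
    model f α z (x + h) ≤ model f α z x + inner ℝ (gradient (model f α z) x) h
      + (L + α) / 2 * ‖h‖ ^ 2 := by
  have hf1 : ContDiff ℝ 1 f := hf.1
  have h1 := hf.le_add x h
  rw [gradient_model (hf1.differentiable (by norm_num))]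
  unfold model
  rw [norm_sub_add_sq, inner_add_left, real_inner_smul_left]
  linarith

/-- A perturbed gradient step decreases the model. -/
theorem model_step_lt {L α ε : ℝ} (hL : 0 < L + α) (hf : HasLipschitzDeriv 1 L f)
    (z x ξ : Vec d) (hε : 0 < ε) (hg : ε < ‖gradient (model f α z) x‖) (hξ : ‖ξ‖ ≤ 1) :
    model f α z (x - (1 / (L + α)) • gradient (model f α z) x + (ε / (8 * (L + α))) • ξ)
      < model f α z x := by
  set g := gradient (model f α z) x
  set M := L + α
  have h := model_add_le (α := α) hf z x (-((1 / M) • g) + (ε / (8 * M)) • ξ)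
  rw [← add_assoc, ← sub_eq_add_neg] at h
  refine h.trans_lt ?_
  rw [norm_add_sq_real, inner_add_right, inner_neg_right, inner_neg_left, norm_neg, norm_smul,
    norm_smul, real_inner_smul_left, real_inner_smul_right, real_inner_smul_right,
    real_inner_self_eq_norm_sq, Real.norm_of_nonneg (by positivity),
    Real.norm_of_nonneg (by positivity)]
  have e1 : ‖ξ‖ ^ 2 ≤ 1 := pow_le_one₀ (norm_nonneg _) hξ
  have e2 : ε ^ 2 < ‖g‖ ^ 2 := by gcongr
  -- The step `-g/M` minimises the quadratic upper bound, so the terms linear in `ξ` cancel and the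
  -- perturbation costs only its square, `1/64` of `ε²` at most.
  have : -(1 / M * ‖g‖ ^ 2) + ε / (8 * M) * inner ℝ g ξ + M / 2 * ((1 / M * ‖g‖) ^ 2
      + 2 * -(1 / M * (ε / (8 * M) * inner ℝ g ξ)) + (ε / (8 * M) * ‖ξ‖) ^ 2)
      = (ε ^ 2 * ‖ξ‖ ^ 2 / 64 - ‖g‖ ^ 2) / (2 * M) := by
    field_simp
    ring
  have e3 : (ε ^ 2 * ‖ξ‖ ^ 2 / 64 - ‖g‖ ^ 2) / (2 * M) < 0 := by
    apply div_neg_of_neg_of_pos _ (by positivity)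
    nlinarith [sq_nonneg ε]
  linarith

end Calculus

/-! ### Exploiting a certificate of nonconvexity -/

section Exploit

variable {d : ℕ} {f : Vec d → ℝ}

theorem argmin_getD_le {ι : Type*} (l : List ι) (v : ι → ℝ) (i₀ : ι) {i : ι} (hi : i ∈ l) :
    v ((l.argmin v).getD i₀) ≤ v i := by
  cases h : l.argmin v with
  | none => simp_all [List.argmin_eq_none]
  | some j => exact List.le_of_mem_argmin hi (by simpa using h)

theorem exploitNC_le (P : Prices) (c s : Vec d) {R θ : ℝ}
    (hθ : θ ∈ [12 * R, 9 * R, -9 * R, -12 * R]) :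
    f (exploitNC P f c s R).val ≤ f (c + θ • s) :=
  argmin_getD_le _ (fun θ => f (c + θ • s)) 0 hθ

theorem exploitNC_le_of_curvature (P : Prices) {L R : ℝ} (hR : 0 < R)
    (hf : HasLipschitzDeriv 3 L f) {u p : Vec d} (hp : ‖p‖ = 1)
    (hc : inner ℝ p (hessian f u p) < -(21 * L * R ^ 2)) :
    f (exploitNC P f u p R).val ≤ f u - 500 * L * R ^ 4 := by
  have hf3 : ContDiff ℝ 3 f := hf.1
  rw [← iteratedDeriv_two_line (hf3.of_le (by norm_num))] at hc
  obtain ⟨θ, hθ, h⟩ := exists_decrease_of_curvature hR (contDiff_line hf3 u p)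
    (hf.2 u p hp.le) hc
  refine (exploitNC_le P u p hθ).trans ?_
  simpa using h

/-- The penalty exceeds its tangent at `v` by `α/2 ‖u - v‖²` at `u`. With `2h = ‖v - u‖` this is the
term `2 α h²` of the one-dimensional lemma, and what remains concerns `f` alone. Both points lie in
the ball, hence `h ≤ R`. -/
theorem exploitNC_le_of_tangent (P : Prices) {L R : ℝ} (hL : 0 < L)
    (hf : HasLipschitzDeriv 3 L f) {z u v : Vec d} (hu : ‖u - z‖ ≤ R) (hv : ‖v - z‖ ≤ R)
    (huv : model f (21 * L * R ^ 2) z u < model f (21 * L * R ^ 2) z v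
      + inner ℝ (gradient (model f (21 * L * R ^ 2) z) v) (u - v)) :
    f (exploitNC P f ((1 / 2 : ℝ) • (u + v)) ((1 / ‖v - u‖) • (v - u)) R).val
      ≤ f u - 500 * L * R ^ 4 := by
  have hf3 : ContDiff ℝ 3 f := hf.1
  have hfd : Differentiable ℝ f := hf3.differentiable (by norm_num)
  have hne : v - u ≠ 0 := by
    intro h
    rw [sub_eq_zero] at h
    simp [h] at huv
  have hn : ‖v - u‖ ≠ 0 := norm_ne_zero_iff.2 hne
  set s := (1 / ‖v - u‖) • (v - u) with hs
  set c := (1 / 2 : ℝ) • (u + v) with hc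
  set h := ‖v - u‖ / 2 with hh
  have h0 : 0 < h := by positivity
  have hhR : h ≤ R := by
    have : ‖v - u‖ ≤ ‖v - z‖ + ‖u - z‖ := by
      have := norm_sub_le (v - z) (u - z)
      simpa using this
    rw [hh]
    linarith
  have hs1 : ‖s‖ = 1 := by
    rw [hs, norm_smul]
    simp [hn]
  have hhs : h • s = (1 / 2 : ℝ) • (v - u) := by
    rw [hs, hh, smul_smul]
    congr 1
    field_simp
  have hv' : c + h • s = v := by
    rw [hhs, hc, ← smul_add]
    have : u + v + (v - u) = (2 : ℝ) • v := by rw [two_smul]; abel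
    rw [this, smul_smul]
    norm_num
  have hu' : c + (-h) • s = u := by
    rw [neg_smul, hhs, hc, ← sub_eq_add_neg, ← smul_sub]
    have : u + v - (v - u) = (2 : ℝ) • u := by rw [two_smul]; abel
    rw [this, smul_smul]
    norm_num
  have hvs : u - v = (-(2 * h)) • s := by
    rw [neg_smul, mul_smul, hhs, smul_smul]
    norm_num
  have key : f u < f v - 2 * h * inner ℝ (gradient f v) s - 2 * (21 * L * R ^ 2) * h ^ 2 := by
    rw [gradient_model hfd, inner_add_left, real_inner_smul_left] at huv
    unfold model at huv
    have h1 := norm_sub_add_sq z v (u - v)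
    rw [add_sub_cancel] at h1
    have h2 : inner ℝ (gradient f v) (u - v) = -(2 * h) * inner ℝ (gradient f v) s := by
      rw [hvs, real_inner_smul_right]
    have h3 : ‖u - v‖ ^ 2 = 4 * h ^ 2 := by
      rw [norm_sub_rev, hh]
      ring
    rw [h2, h1, h3] at huv
    linarith
  obtain ⟨θ, hθ, hle⟩ := exists_decrease_of_tangent hL h0 hhR (contDiff_line hf3 c s)
    (hf.2 c s hs1.le) (by rw [deriv_line hfd, hv', hu']; exact key)
  rw [hu'] at hle
  exact (exploitNC_le P c s hθ).trans hle

end Exploit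

/-! ### The cutting plane method -/

section CuttingPlane

variable {d : ℕ} {P : Prices} {centre : Set (Vec d) → Vec d} {e : Vec d} {g : Vec d → ℝ}
  {z : Vec d} {R : ℝ}

theorem isCompact_region {n : ℕ} (z : Vec d) (R : ℝ) (cuts : Fin n → Vec d × Vec d) :
    IsCompact (region z R cuts) := by
  refine (isCompact_closedBall z R).inter_right ?_
  simp only [Set.ofPred_forall]
  exact isClosed_iInter fun i => isClosed_le (by fun_prop) continuous_const

theorem convex_region {n : ℕ} (z : Vec d) (R : ℝ) (cuts : Fin n → Vec d × Vec d) :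
    Convex ℝ (region z R cuts) := by
  refine (convex_closedBall z R).inter ?_
  simp only [Set.ofPred_forall]
  refine convex_iInter fun i => ?_
  simp only [inner_sub_right, sub_nonpos]
  exact convex_halfSpace_le (innerSL ℝ (cuts i).2).isLinear _

/-- The cuts encoded by a list of queries. -/
noncomputable def cutData {n : ℕ} (e : Vec d) (qs : Fin n → Query d) (i : Fin n) : Vec d × Vec d :=
  ((qs i).point, cutNormal e (qs i))

theorem region_snoc {n : ℕ} (z : Vec d) (R : ℝ) (qs : Fin n → Query d) (q : Query d) :
    region z R (cutData e (Fin.snoc (α := fun _ => Query d) qs q)) =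
      region z R (cutData e qs) ∩ cut e q := by
  refine Set.ext fun y => ⟨fun h => ⟨⟨h.1, fun i => ?_⟩, ?_⟩, fun h => ⟨h.1.1, fun i => ?_⟩⟩
  · have := h.2 i.castSucc
    rwa [cutData, Fin.snoc_castSucc (α := fun _ => Query d)] at this
  · have := h.2 (Fin.last n)
    rwa [cutData, Fin.snoc_last (α := fun _ => Query d)] at this
  · refine Fin.lastCases ?_ (fun i => ?_) i
    · rw [cutData, Fin.snoc_last (α := fun _ => Query d)]
      exact h.2
    · rw [cutData, Fin.snoc_castSucc (α := fun _ => Query d)]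
      exact h.1.2 i

theorem cuttingPlaneMethod_succ_queries (N : ℕ) :
    (cuttingPlaneMethod P centre e g z R (N + 1)).val.2 =
      Fin.snoc (α := fun _ => Query d) (cuttingPlaneMethod P centre e g z R N).val.2
        (query P g (centre (cuttingPlaneMethod P centre e g z R N).val.1)).val := rfl

theorem cuttingPlaneMethod_region (N : ℕ) :
    (cuttingPlaneMethod P centre e g z R N).val.1 =
      region z R (cutData e (cuttingPlaneMethod P centre e g z R N).val.2) := by
  induction N with
  | zero =>
    change Metric.closedBall z R ∩ cut e _ = Metric.closedBall z R ∩ _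
    congr 1
    ext y
    exact ⟨fun h _ => h, fun h => h 0⟩
  | succ N ih =>
    change (cuttingPlaneMethod P centre e g z R N).val.1 ∩ cut e _ = _
    rw [cuttingPlaneMethod_succ_queries, region_snoc, ← ih]
    rfl

theorem cuttingPlaneMethod_query (N : ℕ) (i : Fin (N + 1)) :
    (cuttingPlaneMethod P centre e g z R N).val.2 i =
      (query P g ((cuttingPlaneMethod P centre e g z R N).val.2 i).point).val := by
  induction N with
  | zero => rfl
  | succ N ih =>
    rw [cuttingPlaneMethod_succ_queries]
    refine Fin.lastCases ?_ (fun i => ?_) i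
    · simp [query, charge]
    · simpa using ih i

theorem cuttingPlaneMethod_query_zero (N : ℕ) :
    (cuttingPlaneMethod P centre e g z R N).val.2 0 = (query P g z).val := by
  induction N with
  | zero => rfl
  | succ N ih =>
    rw [cuttingPlaneMethod_succ_queries, ← ih]
    exact Fin.snoc_castSucc (α := fun _ => Query d) _ _ (0 : Fin (N + 1))

theorem cuttingPlaneMethod_time (N : ℕ) :
    (cuttingPlaneMethod P centre e g z R N).time =
      (((N + 1) * (P.T1 + 5 * P.vec d) + N * P.TC : ℝ≥0) : ℝ≥0∞) := by
  induction N with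
  | zero =>
    change ((P.T1 + 5 * P.vec d : ℝ≥0) : ℝ≥0∞) + 0 = _
    simp
  | succ N ih =>
    change (cuttingPlaneMethod P centre e g z R N).time + ((P.TC : ℝ≥0∞) +
      (((P.T1 + 5 * P.vec d : ℝ≥0) : ℝ≥0∞) + 0)) = _
    rw [ih, add_zero, ← ENNReal.coe_add, ← ENNReal.coe_add]
    congr 1
    push_cast
    ring

theorem mem_cut_self (q : Query d) : q.point ∈ cut e q := by simp [cut]

variable (hc : ∀ S : Set (Vec d), S.Nonempty → IsCompact S → Convex ℝ S → centre S ∈ S)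
include hc

/-- Each half-space contains the point it is drawn through, so the latest centre survives its own
cut and the membership property of `centre` keeps applying. -/
theorem cuttingPlaneMethod_nonempty (hR : 0 ≤ R) (N : ℕ) :
    (cuttingPlaneMethod P centre e g z R N).val.1.Nonempty := by
  induction N with
  | zero =>
    refine ⟨z, ?_, ?_⟩
    · simpa using hR
    · exact mem_cut_self (query P g z).val
  | succ N ih =>
    refine ⟨centre (cuttingPlaneMethod P centre e g z R N).val.1, ?_, ?_⟩
    · refine hc _ ih ?_ ?_ <;> rw [cuttingPlaneMethod_region]
      · exact isCompact_region _ _ _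
      · exact convex_region _ _ _
    · exact mem_cut_self (query P g _).val

theorem cuttingPlaneMethod_point_mem (hR : 0 ≤ R) (N : ℕ) (i : Fin (N + 1)) :
    ((cuttingPlaneMethod P centre e g z R N).val.2 i).point ∈ Metric.closedBall z R := by
  induction N with
  | zero => exact Metric.mem_closedBall_self hR
  | succ N ih =>
    rw [cuttingPlaneMethod_succ_queries]
    refine Fin.lastCases ?_ (fun i => ?_) i
    · rw [Fin.snoc_last]
      have h : centre (cuttingPlaneMethod P centre e g z R N).val.1 ∈
          (cuttingPlaneMethod P centre e g z R N).val.1 := by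
        refine hc _ (cuttingPlaneMethod_nonempty hc hR N) ?_ ?_ <;> rw [cuttingPlaneMethod_region]
        · exact isCompact_region _ _ _
        · exact convex_region _ _ _
      exact ((cuttingPlaneMethod_region N).subset h).1
    · simpa using ih i

end CuttingPlane

/-! ### The certificate of nonconvexity -/

section Certificate

variable {d N : ℕ}

/-- The query with the smallest value. -/
noncomputable def bestQuery (qs : Fin (N + 1) → Query d) : Query d :=
  qs (((List.finRange (N + 1)).argmin fun i => (qs i).value).getD 0)

/-- The candidate generated from the point `x` of the unit ball. -/
noncomputable def candidate (q : Query d) (L ε : ℝ) (x : Vec d) : Vec d :=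
  q.point - (1 / L) • q.slope + (ε / (8 * L)) • x

open Classical in
/-- The index of the first point outside `S`, or `0` if there is none. -/
noncomputable def firstOutside (S : Set (Vec d)) (u : ℕ → Vec d) : ℕ :=
  if h : ∃ k, u k ∉ S then Nat.find h else 0

theorem firstOutside_not_mem {S : Set (Vec d)} {u : ℕ → Vec d} (h : ∃ k, u k ∉ S) :
    u (firstOutside S u) ∉ S := by
  classical
  rw [firstOutside, dif_pos h]
  exact Nat.find_spec h

theorem mem_of_lt_firstOutside {S : Set (Vec d)} {u : ℕ → Vec d} {k : ℕ}
    (hk : k < firstOutside S u) : u k ∈ S := by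
  classical
  by_cases h : ∃ k, u k ∉ S
  · rw [firstOutside, dif_pos h] at hk
    simpa using Nat.find_min h hk
  · push Not at h
    exact h k

theorem rejectionLoop_fst (price : ℝ≥0) (u : ℕ → Vec d) (S : Set (Vec d)) :
    (rejectionLoop price u S).val.1 = u (firstOutside S u) := by
  unfold rejectionLoop firstOutside
  split_ifs <;> rfl

theorem rejectionLoop_time {price : ℝ≥0} {u : ℕ → Vec d} {S : Set (Vec d)} (h : ∃ k, u k ∉ S) :
    (rejectionLoop price u S).time = (((firstOutside S u + 1) * price : ℝ≥0) : ℝ≥0∞) := by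
  classical
  unfold rejectionLoop firstOutside
  simp only [dif_pos h]
  push_cast
  rfl

open Classical in
/-- The first query whose tangent inequality is violated at `u`. -/
noncomputable def violatedTangent (g : Vec d → ℝ) (qs : Fin (N + 1) → Query d) (u : Vec d) :
    Option (Fin (N + 1)) :=
  (List.finRange (N + 1)).find? fun i =>
    decide (g u < (qs i).value + inner ℝ (qs i).slope (u - (qs i).point))

open Classical in
theorem nonconvexityCertificate_u (P : Prices) (g : Vec d → ℝ) (S : Set (Vec d)) (x₀ : Vec d)
    (qs : Fin (N + 1) → Query d) (L ε R : ℝ) (ξ : ℕ → Vec d) :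
    (nonconvexityCertificate P g S x₀ qs L ε R ξ).val.1 =
      if ‖(bestQuery qs).slope‖ ≤ ε then (bestQuery qs).point
      else candidate (bestQuery qs) L ε
        (ξ (firstOutside S fun k => candidate (bestQuery qs) L ε (ξ k))) := by
  by_cases h : ‖(bestQuery qs).slope‖ ≤ ε
  · rw [if_pos h]
    exact congrArg (fun t : Timed (Vec d × Option (Vec d) × ℕ) => t.val.1) (if_pos h)
  · rw [if_neg h, ← rejectionLoop_fst ((3 + 2 + 2 * (N + 1)) * P.vec d)
      (fun k => candidate (bestQuery qs) L ε (ξ k)) S]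
    refine (congrArg (fun t : Timed (Vec d × Option (Vec d) × ℕ) => t.val.1) (if_neg h)).trans ?_
    set u := (rejectionLoop ((3 + 2 + 2 * (N + 1)) * P.vec d)
      (fun k => candidate (bestQuery qs) L ε (ξ k)) S).val.1
    by_cases h2 : decide (‖u - x₀‖ ≤ R) = true
    · exact congrArg (fun t : Timed (Vec d × Option (Vec d) × ℕ) => t.val.1) (if_pos h2)
    · exact congrArg (fun t : Timed (Vec d × Option (Vec d) × ℕ) => t.val.1) (if_neg h2)

open Classical in
theorem nonconvexityCertificate_v (P : Prices) (g : Vec d → ℝ) (S : Set (Vec d)) (x₀ : Vec d)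
    (qs : Fin (N + 1) → Query d) (L ε R : ℝ) (ξ : ℕ → Vec d) :
    (nonconvexityCertificate P g S x₀ qs L ε R ξ).val.2.1 =
      if ‖(bestQuery qs).slope‖ ≤ ε then none
      else if ‖(nonconvexityCertificate P g S x₀ qs L ε R ξ).val.1 - x₀‖ ≤ R then
        (violatedTangent g qs (nonconvexityCertificate P g S x₀ qs L ε R ξ).val.1).map
          fun i => (qs i).point
      else none := by
  by_cases h : ‖(bestQuery qs).slope‖ ≤ ε
  · rw [if_pos h]
    exact congrArg (fun t : Timed (Vec d × Option (Vec d) × ℕ) => t.val.2.1) (if_pos h)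
  · rw [nonconvexityCertificate_u, if_neg h, if_neg h,
      ← rejectionLoop_fst ((3 + 2 + 2 * (N + 1)) * P.vec d)
      (fun k => candidate (bestQuery qs) L ε (ξ k)) S]
    refine (congrArg (fun t : Timed (Vec d × Option (Vec d) × ℕ) => t.val.2.1) (if_neg h)).trans ?_
    set u := (rejectionLoop ((3 + 2 + 2 * (N + 1)) * P.vec d)
      (fun k => candidate (bestQuery qs) L ε (ξ k)) S).val.1
    by_cases h2 : ‖u - x₀‖ ≤ R
    · rw [if_pos h2]
      exact congrArg (fun t : Timed (Vec d × Option (Vec d) × ℕ) => t.val.2.1)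
        (if_pos (decide_eq_true h2))
    · rw [if_neg h2]
      exact congrArg (fun t : Timed (Vec d × Option (Vec d) × ℕ) => t.val.2.1)
        (if_neg (decide_eq_true_iff.not.2 h2))

/-- The hypothesis `h` makes the rejection loop terminate. A call that draws nothing is overcharged
by the same bound, so no case distinction is needed later. -/
theorem nonconvexityCertificate_time (P : Prices) (g : Vec d → ℝ) (S : Set (Vec d)) (x₀ : Vec d)
    (qs : Fin (N + 1) → Query d) (L ε R : ℝ) (ξ : ℕ → Vec d)
    (h : ∃ k, candidate (bestQuery qs) L ε (ξ k) ∉ S) :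
    (nonconvexityCertificate P g S x₀ qs L ε R ξ).time ≤
      ((P.T1 + (5 * N + 16) * P.vec d +
        (firstOutside S (fun k => candidate (bestQuery qs) L ε (ξ k)) + 1) *
          ((2 * N + 7) * P.vec d) : ℝ≥0) : ℝ≥0∞) := by
  classical
  set K := firstOutside S (fun k => candidate (bestQuery qs) L ε (ξ k))
  by_cases h1 : ‖(bestQuery qs).slope‖ ≤ ε
  · have : (nonconvexityCertificate P g S x₀ qs L ε R ξ).time
        = (((N + 2) * P.vec d : ℝ≥0) : ℝ≥0∞) + 0 :=
      congrArg (fun t : Timed (Vec d × Option (Vec d) × ℕ) =>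
        (((N + 2) * P.vec d : ℝ≥0) : ℝ≥0∞) + t.time) (if_pos h1)
    rw [this, add_zero, ENNReal.coe_le_coe]
    have h2 : ((N : ℝ≥0) + 2) * P.vec d ≤ (5 * N + 16) * P.vec d := by
      gcongr
      · exact le_mul_of_one_le_left (zero_le) (by norm_num)
      · norm_num
    exact h2.trans (le_add_of_le_of_nonneg (le_add_of_nonneg_left zero_le) zero_le)
  · have hl := rejectionLoop_time (price := (3 + 2 + 2 * (N + 1)) * P.vec d) h
    set l := rejectionLoop ((3 + 2 + 2 * (N + 1)) * P.vec d)
      (fun k => candidate (bestQuery qs) L ε (ξ k)) S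
    have h3 : (nonconvexityCertificate P g S x₀ qs L ε R ξ).time ≤
        (((N + 2) * P.vec d : ℝ≥0) : ℝ≥0∞) + (((3 * P.vec d : ℝ≥0) : ℝ≥0∞) + (l.time +
          (((2 * P.vec d : ℝ≥0) : ℝ≥0∞) + (((P.T1 + 5 * P.vec d : ℝ≥0) : ℝ≥0∞) +
            (((4 * (N + 1) * P.vec d : ℝ≥0) : ℝ≥0∞) + 0))))) := by
      refine (congrArg (fun t : Timed (Vec d × Option (Vec d) × ℕ) =>
        (((N + 2) * P.vec d : ℝ≥0) : ℝ≥0∞) + t.time) (if_neg h1)).trans_le ?_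
      refine add_le_add le_rfl (add_le_add le_rfl (add_le_add le_rfl (add_le_add le_rfl ?_)))
      by_cases h2 : decide (‖l.val.1 - x₀‖ ≤ R) = true
      · exact (congrArg Timed.time (if_pos h2)).le
      · exact (congrArg Timed.time (if_neg h2)).trans_le zero_le
    refine h3.trans (le_of_eq ?_)
    rw [hl, add_zero]
    simp only [← ENNReal.coe_add]
    congr 1
    ring

end Certificate

/-! ### One call of the trust region procedure -/

/-- The data of the procedure. -/
structure Setup (d : ℕ) where
  P : Prices
  centre : Set (Vec d) → Vec d
  e : Vec d
  τ : ℝ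
  eig : (Vec d →L[ℝ] Vec d) → Vec d
  f : Vec d → ℝ
  ε : ℝ
  L₁ : ℝ
  L₃ : ℝ
  R : ℝ

namespace Setup

variable {d : ℕ} (A : Setup d)

/-- The weight of the penalty. -/
noncomputable def pen : ℝ := 21 * A.L₃ * A.R ^ 2

/-- The smoothness constant of the model. -/
noncomputable def smooth : ℝ := A.L₁ + A.pen

/-- The number of cutting plane steps. -/
noncomputable def steps : ℕ := numSteps d A.τ A.smooth A.R (A.ε / 2)

/-- The queries of the cutting plane method. -/
noncomputable def queries (z : Vec d) : Fin (A.steps + 1) → Query d :=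
  (cuttingPlaneMethod A.P A.centre A.e (model A.f A.pen z) z A.R A.steps).val.2

/-- The region kept by the cutting plane method. -/
noncomputable def kept (z : Vec d) : Set (Vec d) :=
  (cuttingPlaneMethod A.P A.centre A.e (model A.f A.pen z) z A.R A.steps).val.1

/-- The candidate obtained from the point `x` of the unit ball. -/
noncomputable def cand (z x : Vec d) : Vec d :=
  candidate (bestQuery (A.queries z)) A.smooth (A.ε / 2) x

/-- The index of the accepted random point. -/
noncomputable def accepted (z : Vec d) (ξ : ℕ → Vec d) : ℕ :=
  firstOutside (A.kept z) fun k => A.cand z (ξ k)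

open Classical in
/-- The first point of the certificate. -/
noncomputable def certU (z : Vec d) (ξ : ℕ → Vec d) : Vec d :=
  if ‖(bestQuery (A.queries z)).slope‖ ≤ A.ε / 2 then (bestQuery (A.queries z)).point
  else A.cand z (ξ (A.accepted z ξ))

open Classical in
/-- The index of the query that yields the second point of the certificate. -/
noncomputable def certV (z : Vec d) (ξ : ℕ → Vec d) : Option (Fin (A.steps + 1)) :=
  if ‖(bestQuery (A.queries z)).slope‖ ≤ A.ε / 2 then none
  else if ‖A.certU z ξ - z‖ ≤ A.R then
    violatedTangent (model A.f A.pen z) (A.queries z) (A.certU z ξ)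
  else none

/-- The point obtained by exploiting the certificate `(u, v)`. -/
noncomputable def exploitPair (u v : Vec d) : Vec d :=
  (exploitNC A.P A.f ((1 / 2 : ℝ) • (u + v)) ((1 / ‖v - u‖) • (v - u)) A.R).val

open Classical in
/-- The result of a call at the first point `u` of the certificate, where `v` is the second one. -/
noncomputable def finish (u : Vec d) (v : Option (Vec d)) : Vec d :=
  if ‖gradient A.f u‖ ≤ A.ε then
    if -A.pen ≤ inner ℝ (A.eig (hessian A.f u)) (hessian A.f u (A.eig (hessian A.f u))) then u
    else (exploitNC A.P A.f u (A.eig (hessian A.f u)) A.R).val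
  else v.elim u (A.exploitPair u)

/-- The point returned by a call. -/
noncomputable def next (z : Vec d) (ξ : ℕ → Vec d) : Vec d :=
  A.finish (A.certU z ξ) ((A.certV z ξ).map fun i => (A.queries z i).point)

/-- A call of the procedure. -/
noncomputable def call (z : Vec d) (ξ : ℕ → Vec d) : Timed (Vec d × ℕ) :=
  cuttingTrustRegion A.P A.centre A.e A.τ A.eig A.f z A.ε A.L₁ A.L₃ A.R ξ

/-- The certificate computed during a call. -/
noncomputable def cert (z : Vec d) (ξ : ℕ → Vec d) : Timed (Vec d × Option (Vec d) × ℕ) :=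
  nonconvexityCertificate A.P (model A.f A.pen z) (A.kept z) z (A.queries z) A.smooth (A.ε / 2)
    A.R ξ

theorem cert_fst (z : Vec d) (ξ : ℕ → Vec d) : (A.cert z ξ).val.1 = A.certU z ξ :=
  nonconvexityCertificate_u ..

theorem cert_snd (z : Vec d) (ξ : ℕ → Vec d) :
    (A.cert z ξ).val.2.1 = (A.certV z ξ).map fun i => (A.queries z i).point := by
  unfold cert certV
  rw [nonconvexityCertificate_v, ← A.cert_fst]
  unfold cert
  split_ifs <;> rfl

open Classical in
/-- The part of a call that follows the computation of the certificate and of a gradient. -/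
noncomputable def finishTimed (u : Vec d) (v : Option (Vec d)) (K : ℕ) : Timed (Vec d × ℕ) := do
  if ‖gradient A.f u‖ ≤ A.ε then
    let H ← charge A.P.T2 (hessian A.f u)
    let p ← charge (A.P.svd d) (A.eig H)
    let curv ← charge (A.P.svd d + A.P.vec d) (inner ℝ p (H p))
    if -A.pen ≤ curv then
      return (u, K)
    else
      let zplus ← exploitNC A.P A.f u p A.R
      return (zplus, K)
  else
    match v with
    | none => return (u, K)
    | some v =>
      let mid ← charge (2 * A.P.vec d) ((1 / 2 : ℝ) • (u + v))
      let s ← charge (3 * A.P.vec d) ((1 / ‖v - u‖) • (v - u))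
      let zplus ← exploitNC A.P A.f mid s A.R
      return (zplus, K)

theorem finishTimed_fst (u : Vec d) (v : Option (Vec d)) (K : ℕ) :
    (A.finishTimed u v K).val.1 = A.finish u v := by
  unfold finish
  split_ifs with h1 h2
  · refine (congrArg (fun t : Timed (Vec d × ℕ) => t.val.1) (if_pos h1)).trans ?_
    exact congrArg (fun t : Timed (Vec d × ℕ) => t.val.1) (if_pos h2)
  · refine (congrArg (fun t : Timed (Vec d × ℕ) => t.val.1) (if_pos h1)).trans ?_
    exact congrArg (fun t : Timed (Vec d × ℕ) => t.val.1) (if_neg h2)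
  · refine (congrArg (fun t : Timed (Vec d × ℕ) => t.val.1) (if_neg h1)).trans ?_
    cases v <;> rfl

theorem finishTimed_time (u : Vec d) (v : Option (Vec d)) (K : ℕ) :
    (A.finishTimed u v K).time ≤
      ((A.P.T2 + 2 * A.P.svd d + 4 * A.P.T1 + 20 * A.P.vec d : ℝ≥0) : ℝ≥0∞) := by
  have e1 : (0 : ℝ≥0∞) ≤ ((4 * (A.P.T1 + 3 * A.P.vec d) + 2 * A.P.vec d : ℝ≥0) : ℝ≥0∞) + 0 := zero_le
  by_cases h1 : ‖gradient A.f u‖ ≤ A.ε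
  · have h : (A.finishTimed u v K).time ≤ ((A.P.T2 : ℝ≥0) : ℝ≥0∞) + (((A.P.svd d : ℝ≥0) : ℝ≥0∞) +
        (((A.P.svd d + A.P.vec d : ℝ≥0) : ℝ≥0∞) +
          (((4 * (A.P.T1 + 3 * A.P.vec d) + 2 * A.P.vec d : ℝ≥0) : ℝ≥0∞) + 0))) := by
      refine (congrArg Timed.time (if_pos h1)).trans_le ?_
      refine add_le_add le_rfl (add_le_add le_rfl (add_le_add le_rfl ?_))
      by_cases h2 : -A.pen ≤ inner ℝ (A.eig (hessian A.f u)) (hessian A.f u (A.eig (hessian A.f u)))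
      · exact (congrArg Timed.time (if_pos h2)).trans_le e1
      · exact (congrArg Timed.time (if_neg h2)).le
    refine h.trans ?_
    rw [add_zero]
    simp only [← ENNReal.coe_add, ENNReal.coe_le_coe]
    rw [← NNReal.coe_le_coe]
    push_cast
    linarith [(A.P.vec d).2]
  · have h : (A.finishTimed u v K).time ≤ ((2 * A.P.vec d : ℝ≥0) : ℝ≥0∞) +
        (((3 * A.P.vec d : ℝ≥0) : ℝ≥0∞) +
          (((4 * (A.P.T1 + 3 * A.P.vec d) + 2 * A.P.vec d : ℝ≥0) : ℝ≥0∞) + 0)) := by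
      refine (congrArg Timed.time (if_neg h1)).trans_le ?_
      cases v with
      | none => exact zero_le
      | some v => exact le_rfl
    refine h.trans ?_
    rw [add_zero]
    simp only [← ENNReal.coe_add, ENNReal.coe_le_coe]
    rw [← NNReal.coe_le_coe]
    push_cast
    linarith [(A.P.vec d).2, (A.P.svd d).2, A.P.T2.2]

theorem call_eq (z : Vec d) (ξ : ℕ → Vec d) :
    A.call z ξ = charge (A.P.vec d) A.steps >>= fun N =>
      cuttingPlaneMethod A.P A.centre A.e (model A.f A.pen z) z A.R N >>= fun p =>
        nonconvexityCertificate A.P (model A.f A.pen z) p.1 z p.2 A.smooth (A.ε / 2) A.R ξ >>=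
          fun q => charge (A.P.T1 + A.P.vec d) (gradient A.f q.1) >>=
            fun _ => A.finishTimed q.1 q.2.1 q.2.2 := by
  unfold call cuttingTrustRegion
  refine congrArg (bind _) (funext fun N => ?_)
  refine congrArg (bind _) (funext fun p => ?_)
  refine congrArg (bind _) (funext fun q => ?_)
  obtain ⟨u, v, K⟩ := q
  rfl

theorem call_val (z : Vec d) (ξ : ℕ → Vec d) :
    (A.call z ξ).val =
      (A.finishTimed (A.cert z ξ).val.1 (A.cert z ξ).val.2.1 (A.cert z ξ).val.2.2).val := by
  rw [call_eq]
  rfl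

theorem call_time_eq (z : Vec d) (ξ : ℕ → Vec d) :
    (A.call z ξ).time = ((A.P.vec d : ℝ≥0) : ℝ≥0∞) +
      ((cuttingPlaneMethod A.P A.centre A.e (model A.f A.pen z) z A.R A.steps).time +
        ((A.cert z ξ).time + (((A.P.T1 + A.P.vec d : ℝ≥0) : ℝ≥0∞) +
          (A.finishTimed (A.cert z ξ).val.1 (A.cert z ξ).val.2.1 (A.cert z ξ).val.2.2).time))) := by
  rw [call_eq]
  rfl

theorem call_fst (z : Vec d) (ξ : ℕ → Vec d) : (A.call z ξ).val.1 = A.next z ξ := by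
  rw [call_val, finishTimed_fst, cert_fst, cert_snd]
  rfl

/-- Evaluations with first derivatives: `steps + 1` queries, one at `u` for the tangent test, one
for `∇f(u)`, and four to exploit the certificate. -/
theorem call_time (z : Vec d) (ξ : ℕ → Vec d) (h : ∃ k, A.cand z (ξ k) ∉ A.kept z) :
    (A.call z ξ).time ≤ (((A.steps + 7) * (A.P.T1 + 10 * A.P.vec d) + A.steps * A.P.TC + A.P.T2 +
      2 * A.P.svd d + (A.accepted z ξ + 1) * ((2 * A.steps + 7) * A.P.vec d) : ℝ≥0) : ℝ≥0∞) := by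
  have h1 := nonconvexityCertificate_time A.P (model A.f A.pen z) (A.kept z) z (A.queries z)
    A.smooth (A.ε / 2) A.R ξ h
  rw [call_time_eq, cuttingPlaneMethod_time]
  refine (add_le_add le_rfl (add_le_add le_rfl
    (add_le_add h1 (add_le_add le_rfl (A.finishTimed_time _ _ _))))).trans ?_
  simp only [← ENNReal.coe_add, ENNReal.coe_le_coe]
  rw [← NNReal.coe_le_coe]
  change _ ≤ (((A.steps + 7) * (A.P.T1 + 10 * A.P.vec d) + A.steps * A.P.TC + A.P.T2 +
    2 * A.P.svd d + (firstOutside (A.kept z) (fun k => candidate (bestQuery (A.queries z)) A.smooth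
      (A.ε / 2) (ξ k)) + 1) * ((2 * A.steps + 7) * A.P.vec d) : ℝ≥0) : ℝ)
  push_cast
  linarith [(A.P.vec d).2]

/-- The assumptions on the data of the procedure. -/
structure Valid (A : Setup d) : Prop where
  dim_pos : 0 < d
  cutting : CuttingPlaneAssumption A.P A.centre A.e A.τ
  minDir : IsMinDirection A.eig
  L₁_pos : 0 < A.L₁
  L₃_pos : 0 < A.L₃
  ε_pos : 0 < A.ε
  R_pos : 0 < A.R
  lip₁ : HasLipschitzDeriv 1 A.L₁ A.f
  lip₃ : HasLipschitzDeriv 3 A.L₃ A.f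

variable {A} (hA : A.Valid)
include hA

theorem Valid.pen_pos : 0 < A.pen := by
  have := hA.L₃_pos
  have := hA.R_pos
  unfold pen
  positivity

theorem Valid.smooth_pos : 0 < A.smooth := add_pos hA.L₁_pos hA.pen_pos

theorem Valid.contDiff : ContDiff ℝ 3 A.f := hA.lip₃.1

theorem Valid.contDiff_two : ContDiff ℝ 2 A.f := hA.contDiff.of_le (by norm_num)

theorem Valid.differentiable : Differentiable ℝ A.f := hA.contDiff.differentiable (by norm_num)

omit hA in
theorem queries_value (z : Vec d) (i) :
    (A.queries z i).value = model A.f A.pen z (A.queries z i).point :=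
  congrArg Query.value (cuttingPlaneMethod_query A.steps i)

omit hA in
theorem queries_slope (z : Vec d) (i) :
    (A.queries z i).slope = gradient (model A.f A.pen z) (A.queries z i).point :=
  congrArg Query.slope (cuttingPlaneMethod_query A.steps i)

omit hA in
theorem best_value_le (z : Vec d) (i) :
    (bestQuery (A.queries z)).value ≤ (A.queries z i).value :=
  argmin_getD_le _ (fun i => (A.queries z i).value) 0 (List.mem_finRange i)

omit hA in
theorem best_value (z : Vec d) : (bestQuery (A.queries z)).value =
    model A.f A.pen z (bestQuery (A.queries z)).point := queries_value z _

omit hA in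
theorem best_slope (z : Vec d) : (bestQuery (A.queries z)).slope =
    gradient (model A.f A.pen z) (bestQuery (A.queries z)).point := queries_slope z _

omit hA in
theorem best_value_le_self (z : Vec d) : (bestQuery (A.queries z)).value ≤ A.f z := by
  refine (best_value_le z 0).trans_eq ?_
  have : A.queries z 0 = (query A.P (model A.f A.pen z) z).val := cuttingPlaneMethod_query_zero _
  rw [this]
  change model A.f A.pen z z = A.f z
  simp [model]

/-- What is known about the certificate. -/
theorem Valid.certificate (z : Vec d) {ξ : ℕ → Vec d} (hξ : ∀ k, ‖ξ k‖ ≤ 1)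
    (h : ∃ k, A.cand z (ξ k) ∉ A.kept z) :
    model A.f A.pen z (A.certU z ξ) ≤ A.f z ∧
      ((A.certV z ξ = none ∧ (‖gradient (model A.f A.pen z) (A.certU z ξ)‖ ≤ A.ε / 2 ∨
        A.R < ‖A.certU z ξ - z‖)) ∨
      ∃ i, A.certV z ξ = some i ∧ ‖A.certU z ξ - z‖ ≤ A.R ∧ ‖(A.queries z i).point - z‖ ≤ A.R ∧
        model A.f A.pen z (A.certU z ξ) < model A.f A.pen z (A.queries z i).point +
          inner ℝ (gradient (model A.f A.pen z) (A.queries z i).point)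
            (A.certU z ξ - (A.queries z i).point)) := by
  classical
  by_cases h1 : ‖(bestQuery (A.queries z)).slope‖ ≤ A.ε / 2
  · have hu : A.certU z ξ = (bestQuery (A.queries z)).point := if_pos h1
    have hv : A.certV z ξ = none := if_pos h1
    rw [hu, ← best_value]
    refine ⟨best_value_le_self z, Or.inl ⟨hv, Or.inl ?_⟩⟩
    rwa [← best_slope]
  · have hu : A.certU z ξ = A.cand z (ξ (A.accepted z ξ)) := if_neg h1
    have hlt : model A.f A.pen z (A.certU z ξ) < (bestQuery (A.queries z)).value := by
      rw [hu, best_value, cand, candidate, best_slope, smooth]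
      refine model_step_lt hA.smooth_pos hA.lip₁ z _ _ (half_pos hA.ε_pos) ?_ (hξ _)
      rw [← best_slope]
      exact not_le.1 h1
    refine ⟨hlt.le.trans (best_value_le_self z), ?_⟩
    by_cases h2 : ‖A.certU z ξ - z‖ ≤ A.R
    · right
      have hv : A.certV z ξ =
          violatedTangent (model A.f A.pen z) (A.queries z) (A.certU z ξ) := by
        rw [certV, if_neg h1, if_pos h2]
      have hex : ∃ i, model A.f A.pen z (A.certU z ξ) < (A.queries z i).value +
          inner ℝ (A.queries z i).slope (A.certU z ξ - (A.queries z i).point) := by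
        have hn : A.certU z ξ ∉ A.kept z := by
          rw [hu]
          exact firstOutside_not_mem (u := fun k => A.cand z (ξ k)) h
        rw [kept, cuttingPlaneMethod_region] at hn
        have hn' : ¬ ∀ i, inner ℝ (cutNormal A.e (A.queries z i))
            (A.certU z ξ - (A.queries z i).point) ≤ 0 :=
          fun hh => hn ⟨by rwa [mem_closedBall_iff_norm], hh⟩
        push Not at hn'
        obtain ⟨i, hi⟩ := hn'
        refine ⟨i, ?_⟩
        have h3 := hlt.trans_le (best_value_le z i)
        -- If the slope vanishes, the cut used `e`, but the tangent is constant and `h3` already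
        -- violates it. Otherwise the violated cut makes the linear term positive, on top of `h3`.
        by_cases h4 : (A.queries z i).slope = 0
        · simpa [h4] using h3
        · rw [cutNormal, if_neg h4] at hi
          linarith
      obtain ⟨i, hi⟩ := hex
      have hsome : (violatedTangent (model A.f A.pen z) (A.queries z) (A.certU z ξ)).isSome := by
        rw [violatedTangent, List.find?_isSome]
        exact ⟨i, List.mem_finRange i, decide_eq_true hi⟩
      obtain ⟨j, hj⟩ := Option.isSome_iff_exists.1 hsome
      refine ⟨j, hv.trans hj, h2, ?_, ?_⟩
      · rw [← mem_closedBall_iff_norm]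
        exact cuttingPlaneMethod_point_mem hA.cutting.centre_mem hA.R_pos.le _ _
      · have := List.find?_some (p := fun i => decide (model A.f A.pen z (A.certU z ξ) <
          (A.queries z i).value +
            inner ℝ (A.queries z i).slope (A.certU z ξ - (A.queries z i).point))) hj
        rw [decide_eq_true_iff] at this
        rwa [queries_slope, queries_value] at this
    · left
      refine ⟨?_, Or.inr (not_le.1 h2)⟩
      rw [certV, if_neg h1, if_neg h2]

/-- A call finds an approximate stationary point or decreases the objective. -/
theorem Valid.next_progress (z : Vec d) {ξ : ℕ → Vec d} (hξ : ∀ k, ‖ξ k‖ ≤ 1)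
    (h : ∃ k, A.cand z (ξ k) ∉ A.kept z) :
    IsApproxStationary A.f A.ε A.pen (A.next z ξ) ∨
      A.f (A.next z ξ) ≤ A.f z - min (A.ε ^ 2 / (8 * A.pen)) (10 * A.L₃ * A.R ^ 4) := by
  classical
  obtain ⟨h1, h2⟩ := hA.certificate z hξ h
  have hα := hA.pen_pos
  have hL := hA.L₃_pos
  have hR := hA.R_pos
  set u := A.certU z ξ with hu
  have hfu : A.f u + A.pen / 2 * ‖u - z‖ ^ 2 ≤ A.f z := by
    rwa [norm_sub_rev]
  have hM : 0 < A.L₃ * A.R ^ 4 := by positivity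
  have hfu' : A.f u ≤ A.f z := by
    have : 0 ≤ A.pen / 2 * ‖u - z‖ ^ 2 := by positivity
    linarith
  have hmin := min_le_right (A.ε ^ 2 / (8 * A.pen)) (10 * A.L₃ * A.R ^ 4)
  by_cases hg : ‖gradient A.f u‖ ≤ A.ε
  · by_cases hp : -A.pen ≤
        inner ℝ (A.eig (hessian A.f u)) (hessian A.f u (A.eig (hessian A.f u)))
    · left
      have : A.next z ξ = u := by
        rw [next, finish, if_pos hg, if_pos hp]
      rw [this]
      refine ⟨hg, le_lamMin (by linarith) fun s hs => hp.trans ?_⟩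
      exact hA.minDir.le _ (hessian_isSymmetric hA.contDiff_two u) s hs
    · right
      have : A.next z ξ = (exploitNC A.P A.f u (A.eig (hessian A.f u)) A.R).val := by
        rw [next, finish, if_pos hg, if_neg hp]
      rw [this]
      have := exploitNC_le_of_curvature A.P hR hA.lip₃ (hA.minDir.norm_eq _) (not_le.1 hp)
      linarith
  · right
    rcases h2 with ⟨hv, h2⟩ | ⟨i, hv, hb1, hb2, ht⟩
    · have : A.next z ξ = u := by
        rw [next, finish, if_neg hg, hv]
        rfl
      rw [this]
      rcases h2 with h2 | h2
      · rw [gradient_model hA.differentiable] at h2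
        -- The gradient of `f` exceeds `ε` and that of the model is at most `ε/2`; the gradient of
        -- the penalty makes up the difference.
        have h3 : A.ε / 2 ≤ A.pen * ‖u - z‖ := by
          have := norm_sub_le (gradient A.f u + A.pen • (u - z)) (A.pen • (u - z))
          rw [add_sub_cancel_right, norm_smul, Real.norm_of_nonneg hα.le] at this
          linarith [not_le.1 hg]
        have h4 : A.ε ^ 2 / (8 * A.pen) ≤ A.pen / 2 * ‖u - z‖ ^ 2 := by
          rw [div_le_iff₀ (by positivity)]
          have := pow_le_pow_left₀ (half_pos hA.ε_pos).le h3 2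
          linarith
        linarith [min_le_left (A.ε ^ 2 / (8 * A.pen)) (10 * A.L₃ * A.R ^ 4)]
      · have h4 : A.pen / 2 * A.R ^ 2 ≤ A.pen / 2 * ‖u - z‖ ^ 2 := by gcongr
        have h5 : A.pen / 2 * A.R ^ 2 = 21 / 2 * (A.L₃ * A.R ^ 4) := by
          unfold pen
          ring
        linarith
    · have : A.next z ξ = A.exploitPair u (A.queries z i).point := by
        rw [next, finish, if_neg hg, hv]
        rfl
      rw [this]
      have := exploitNC_le_of_tangent A.P hL hA.lip₃ hb1 hb2 ht
      unfold exploitPair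
      linarith

end Setup

/-! ### Measurability of selections -/

section Selection

variable {α β ι : Type*} [MeasurableSpace α] [MeasurableSpace β]

theorem measurable_of_countable_selection [Countable ι] {T : α → ι}
    (hT : ∀ i, MeasurableSet {x | T x = i}) {g : ι → α → β} (hg : ∀ i, Measurable (g i)) :
    Measurable fun x => g (T x) x := by
  intro s hs
  have : (fun x => g (T x) x) ⁻¹' s = ⋃ i, {x | T x = i} ∩ g i ⁻¹' s := by
    ext x
    simp
  rw [this]
  exact MeasurableSet.iUnion fun i => (hT i).inter (hg i hs)

/-- The induction works because `h` and the default are arbitrary: the comparison of the head with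
the winner of the tail is absorbed into a new `h`, and the head becomes the new default. -/
theorem measurable_argmin_elim (l : List ι) {v : α → ι → ℝ} (hv : ∀ i, Measurable fun x => v x i)
    {h : ι → α → β} (hh : ∀ i, Measurable (h i)) {h₀ : α → β} (hh₀ : Measurable h₀) :
    Measurable fun x => (l.argmin (v x)).elim (h₀ x) fun i => h i x := by
  induction l generalizing h h₀ with
  | nil => simpa using hh₀
  | cons a l ih =>
    have := ih (h := fun c x => if v x c < v x a then h c x else h a x) (h₀ := h a)
      (fun c => Measurable.ite (measurableSet_lt (hv c) (hv a)) (hh c) (hh a)) (hh a)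
    convert this using 2 with x
    rw [List.argmin_cons]
    cases List.argmin (v x) l with
    | none => rfl
    | some c =>
      dsimp only [Option.elim]
      split_ifs <;> rfl

open Classical in
theorem measurable_find?_elim (l : List ι) {p : α → ι → Prop}
    (hp : ∀ i, MeasurableSet {x | p x i}) {h : ι → α → β} (hh : ∀ i, Measurable (h i)) {h₀ : α → β}
    (hh₀ : Measurable h₀) :
    Measurable fun x => (l.find? fun i => decide (p x i)).elim (h₀ x) fun i => h i x := by
  induction l with
  | nil => simpa using hh₀
  | cons a l ih =>
    have : Measurable fun x => if p x a then h a x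
        else (l.find? fun i => decide (p x i)).elim (h₀ x) fun i => h i x :=
      Measurable.ite (hp a) (hh a) ih
    convert this using 2 with x
    by_cases hx : p x a <;> simp [hx]

end Selection

namespace Setup

variable {d : ℕ} {A : Setup d} (hA : A.Valid)
include hA

/-! ### Measurability of one call -/

theorem Valid.measurable_f : Measurable A.f := hA.contDiff.continuous.measurable

theorem Valid.measurable_gradient : Measurable (gradient A.f) :=
  (contDiff_gradient hA.contDiff_two).continuous.measurable

theorem Valid.measurable_model {α : Type*} [MeasurableSpace α] {z x : α → Vec d}
    (hz : Measurable z) (hx : Measurable x) :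
    Measurable fun a => model A.f A.pen (z a) (x a) := by
  have := hA.measurable_f.comp hx
  unfold model
  fun_prop

theorem Valid.measurable_gradient_model {α : Type*} [MeasurableSpace α] {z x : α → Vec d}
    (hz : Measurable z) (hx : Measurable x) :
    Measurable fun a => gradient (model A.f A.pen (z a)) (x a) := by
  simp only [gradient_model hA.differentiable]
  have := hA.measurable_gradient.comp hx
  fun_prop

omit hA in
theorem measurable_cutData {n : ℕ} {α : Type*} [MeasurableSpace α] (e : Vec d)
    {qs : α → Fin n → Query d} (h1 : ∀ i, Measurable fun a => (qs a i).point)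
    (h2 : ∀ i, Measurable fun a => (qs a i).slope) :
    Measurable fun a => cutData e (qs a) := by
  classical
  refine measurable_pi_lambda _ fun i => (h1 i).prodMk ?_
  have : MeasurableSet {a | (qs a i).slope = 0} := h2 i (measurableSet_singleton 0)
  exact Measurable.ite this measurable_const (h2 i)

omit hA in
theorem measurable_snoc_point {n : ℕ} {α : Type*} [MeasurableSpace α]
    {qs : α → Fin n → Query d} {q : α → Query d} (h1 : ∀ i, Measurable fun a => (qs a i).point)
    (h2 : Measurable fun a => (q a).point) (i : Fin (n + 1)) :
    Measurable fun a => (Fin.snoc (α := fun _ => Query d) (qs a) (q a) i).point := by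
  refine Fin.lastCases ?_ (fun i => ?_) i
  · simpa only [Fin.snoc_last] using h2
  · simpa only [Fin.snoc_castSucc] using h1 i

/-- The region is determined by the ball and the cuts, so the next centre is a Borel function of `z`
and the earlier queries; their slopes are Borel in the query points because `∇f` is continuous. -/
theorem Valid.measurable_points (N : ℕ) (i : Fin (N + 1)) :
    Measurable fun z => ((cuttingPlaneMethod A.P A.centre A.e (model A.f A.pen z) z A.R N).val.2
      i).point := by
  induction N with
  | zero => exact measurable_id
  | succ N ih =>
    have h : Measurable fun z => A.centre
        (cuttingPlaneMethod A.P A.centre A.e (model A.f A.pen z) z A.R N).val.1 := by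
      simp only [cuttingPlaneMethod_region]
      have h1 : Measurable fun z : Vec d => (z, cutData A.e
          (cuttingPlaneMethod A.P A.centre A.e (model A.f A.pen z) z A.R N).val.2) := by
        refine measurable_id.prodMk (measurable_cutData A.e ih fun i => ?_)
        rw [show (fun z => ((cuttingPlaneMethod A.P A.centre A.e (model A.f A.pen z) z A.R N).val.2
          i).slope) = _ from funext fun z => congrArg Query.slope (cuttingPlaneMethod_query N i)]
        exact hA.measurable_gradient_model measurable_id (ih i)
      exact (hA.cutting.measurable_centre (N + 1) A.R).comp (f := fun z : Vec d => (z, cutData A.e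
          (cuttingPlaneMethod A.P A.centre A.e (model A.f A.pen z) z A.R N).val.2)) h1
    exact measurable_snoc_point ih h i

theorem Valid.measurable_queries_point (i) : Measurable fun z => (A.queries z i).point :=
  hA.measurable_points A.steps i

theorem Valid.measurable_queries_value (i) : Measurable fun z => (A.queries z i).value := by
  simp_rw [queries_value]
  exact hA.measurable_model measurable_id (hA.measurable_queries_point i)

theorem Valid.measurable_queries_slope (i) : Measurable fun z => (A.queries z i).slope := by
  simp_rw [queries_slope]
  exact hA.measurable_gradient_model measurable_id (hA.measurable_queries_point i)

theorem Valid.measurable_best_point : Measurable fun z => (bestQuery (A.queries z)).point := by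
  have := measurable_argmin_elim (List.finRange (A.steps + 1)) hA.measurable_queries_value
    hA.measurable_queries_point (hA.measurable_queries_point 0)
  convert this using 2 with z
  unfold bestQuery
  cases List.argmin (fun i => (A.queries z i).value) (List.finRange (A.steps + 1)) <;> rfl

theorem Valid.measurable_best_slope : Measurable fun z => (bestQuery (A.queries z)).slope := by
  have := measurable_argmin_elim (List.finRange (A.steps + 1)) hA.measurable_queries_value
    hA.measurable_queries_slope (hA.measurable_queries_slope 0)
  convert this using 2 with z
  unfold bestQuery
  cases List.argmin (fun i => (A.queries z i).value) (List.finRange (A.steps + 1)) <;> rfl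

theorem Valid.measurable_cand : Measurable fun p : Vec d × Vec d => A.cand p.1 p.2 := by
  have h1 : Measurable fun p : Vec d × Vec d => (bestQuery (A.queries p.1)).point :=
    hA.measurable_best_point.comp measurable_fst
  have h2 : Measurable fun p : Vec d × Vec d => (bestQuery (A.queries p.1)).slope :=
    hA.measurable_best_slope.comp measurable_fst
  unfold cand candidate
  fun_prop

omit hA in
theorem kept_eq (z : Vec d) : A.kept z = region z A.R (cutData A.e (A.queries z)) :=
  cuttingPlaneMethod_region _

theorem Valid.measurableSet_rejected :
    MeasurableSet {p : Vec d × Vec d | A.cand p.1 p.2 ∈ A.kept p.1} := by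
  simp only [kept_eq]
  have hc := hA.measurable_cand
  have hd : Measurable fun z => cutData A.e (A.queries z) :=
    measurable_cutData A.e hA.measurable_queries_point hA.measurable_queries_slope
  have hd' : Measurable fun p : Vec d × Vec d => cutData A.e (A.queries p.1) :=
    hd.comp measurable_fst
  have h1 : MeasurableSet {p : Vec d × Vec d | A.cand p.1 p.2 ∈ Metric.closedBall p.1 A.R} := by
    simp only [Metric.mem_closedBall]
    exact measurableSet_le (hc.dist measurable_fst) measurable_const
  have h2 : MeasurableSet (⋂ i, {p : Vec d × Vec d | inner ℝ (cutData A.e (A.queries p.1) i).2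
      (A.cand p.1 p.2 - (cutData A.e (A.queries p.1) i).1) ≤ 0}) := by
    refine MeasurableSet.iInter fun i => measurableSet_le ?_ measurable_const
    have h3 := (measurable_pi_apply i).comp hd'
    exact h3.snd.inner (hc.sub h3.fst)
  convert h1.inter h2 using 1
  ext p
  simp [region]

theorem Valid.measurableSet_rejected_seq (k : ℕ) :
    MeasurableSet {p : Vec d × (ℕ → Vec d) | A.cand p.1 (p.2 k) ∈ A.kept p.1} :=
  measurableSet_preimage (f := fun p : Vec d × (ℕ → Vec d) => (p.1, p.2 k))
    (measurable_fst.prodMk ((measurable_pi_apply k).comp measurable_snd)) hA.measurableSet_rejected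

theorem Valid.measurableSet_accepted (k : ℕ) :
    MeasurableSet {p : Vec d × (ℕ → Vec d) | A.accepted p.1 p.2 = k} := by
  classical
  have h := hA.measurableSet_rejected_seq
  -- The second set accounts for the default index `0` when every candidate is rejected.
  have : {p : Vec d × (ℕ → Vec d) | A.accepted p.1 p.2 = k} =
      ({p | A.cand p.1 (p.2 k) ∈ A.kept p.1}ᶜ ∩
        ⋂ j, ⋂ (_ : j < k), {p | A.cand p.1 (p.2 j) ∈ A.kept p.1}) ∪
      (⋂ j, {p | A.cand p.1 (p.2 j) ∈ A.kept p.1} ∩ {_p | k = 0}) := by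
    ext p
    simp only [accepted, firstOutside, Set.mem_ofPred_eq, Set.mem_union, Set.mem_inter_iff,
      Set.mem_compl_iff, Set.mem_iInter]
    split_ifs with hex
    · rw [Nat.find_eq_iff]
      push Not
      constructor
      · exact fun h => Or.inl h
      · rintro (h | h)
        · exact h
        · obtain ⟨k, hk⟩ := hex
          exact absurd (h k).1 hk
    · push Not at hex
      constructor
      · exact fun h => Or.inr fun j => ⟨hex j, h.symm⟩
      · rintro (h | h)
        · exact absurd (hex k) h.1
        · exact (h 0).2.symm
  rw [this]
  exact ((h k).compl.inter (MeasurableSet.iInter fun j => MeasurableSet.iInter fun _ => h j)).union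
    (MeasurableSet.iInter fun j => (h j).inter (MeasurableSet.const _))

theorem Valid.measurable_certU :
    Measurable fun p : Vec d × (ℕ → Vec d) => A.certU p.1 p.2 := by
  unfold certU
  refine Measurable.ite (measurableSet_le ?_ measurable_const) ?_ ?_
  · exact (hA.measurable_best_slope.comp measurable_fst).norm
  · exact hA.measurable_best_point.comp measurable_fst
  · have h (k : ℕ) : Measurable fun p : Vec d × (ℕ → Vec d) => A.cand p.1 (p.2 k) :=
      hA.measurable_cand.comp (f := fun p : Vec d × (ℕ → Vec d) => (p.1, p.2 k))
        (measurable_fst.prodMk ((measurable_pi_apply k).comp measurable_snd))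
    exact measurable_of_countable_selection
      (T := fun p : Vec d × (ℕ → Vec d) => A.accepted p.1 p.2) hA.measurableSet_accepted
      (g := fun k p => A.cand p.1 (p.2 k)) h

theorem Valid.measurable_exploitNC :
    Measurable fun p : Vec d × Vec d => (exploitNC A.P A.f p.1 p.2 A.R).val := by
  have h := measurable_argmin_elim [12 * A.R, 9 * A.R, -9 * A.R, -12 * A.R]
    (v := fun (p : Vec d × Vec d) θ => A.f (p.1 + θ • p.2))
    (fun θ => hA.measurable_f.comp (by fun_prop))
    (h := fun θ p => p.1 + θ • p.2) (fun θ => by fun_prop) (h₀ := fun p => p.1 + (0 : ℝ) • p.2)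
    (by fun_prop)
  convert h using 2 with p
  simp only [exploitNC, charge]
  cases List.argmin (fun θ => A.f (p.1 + θ • p.2)) [12 * A.R, 9 * A.R, -9 * A.R, -12 * A.R] <;> rfl

theorem Valid.measurable_exploitPair :
    Measurable fun p : Vec d × Vec d => A.exploitPair p.1 p.2 :=
  hA.measurable_exploitNC.comp (f := fun p : Vec d × Vec d =>
    ((1 / 2 : ℝ) • (p.1 + p.2), (1 / ‖p.2 - p.1‖) • (p.2 - p.1))) (by fun_prop)

theorem Valid.measurable_direction : Measurable fun u => A.eig (hessian A.f u) :=
  hA.minDir.measurable.comp (continuous_hessian hA.contDiff_two).measurable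

theorem Valid.measurable_curvature :
    Measurable fun u => inner ℝ (A.eig (hessian A.f u)) (hessian A.f u (A.eig (hessian A.f u))) := by
  have h : Continuous fun p : Vec d × Vec d => (inner ℝ p.2 (hessian A.f p.1 p.2) : ℝ) :=
    continuous_snd.inner (((continuous_hessian hA.contDiff_two).comp continuous_fst).clm_apply
      continuous_snd)
  exact h.measurable.comp (f := fun u => (u, A.eig (hessian A.f u))) (measurable_id.prodMk hA.measurable_direction)

theorem Valid.measurable_certV_elim {h : Fin (A.steps + 1) → Vec d × (ℕ → Vec d) → Vec d}
    (hh : ∀ i, Measurable (h i)) {h₀ : Vec d × (ℕ → Vec d) → Vec d} (hh₀ : Measurable h₀) :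
    Measurable fun p : Vec d × (ℕ → Vec d) => (A.certV p.1 p.2).elim (h₀ p) fun i => h i p := by
  classical
  have hu := hA.measurable_certU
  have key : Measurable fun p : Vec d × (ℕ → Vec d) =>
      (violatedTangent (model A.f A.pen p.1) (A.queries p.1) (A.certU p.1 p.2)).elim (h₀ p)
        fun i => h i p := by
    unfold violatedTangent
    refine measurable_find?_elim _ (fun i => measurableSet_lt ?_ ?_) hh hh₀
    · exact hA.measurable_model measurable_fst hu
    · have h1 : Measurable fun p : Vec d × (ℕ → Vec d) => (A.queries p.1 i).point :=
        (hA.measurable_queries_point i).comp measurable_fst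
      have h2 : Measurable fun p : Vec d × (ℕ → Vec d) => (A.queries p.1 i).slope :=
        (hA.measurable_queries_slope i).comp measurable_fst
      have h3 : Measurable fun p : Vec d × (ℕ → Vec d) => (A.queries p.1 i).value :=
        (hA.measurable_queries_value i).comp measurable_fst
      exact h3.add (h2.inner (hu.sub h1))
  have h1 : MeasurableSet {p : Vec d × (ℕ → Vec d) |
      ‖(bestQuery (A.queries p.1)).slope‖ ≤ A.ε / 2} :=
    measurableSet_le (hA.measurable_best_slope.comp measurable_fst).norm measurable_const
  have h2 : MeasurableSet {p : Vec d × (ℕ → Vec d) | ‖A.certU p.1 p.2 - p.1‖ ≤ A.R} :=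
    measurableSet_le (hu.sub measurable_fst).norm measurable_const
  have : Measurable fun p : Vec d × (ℕ → Vec d) =>
      if ‖(bestQuery (A.queries p.1)).slope‖ ≤ A.ε / 2 then h₀ p
      else if ‖A.certU p.1 p.2 - p.1‖ ≤ A.R then
        (violatedTangent (model A.f A.pen p.1) (A.queries p.1) (A.certU p.1 p.2)).elim (h₀ p)
          fun i => h i p
      else h₀ p := Measurable.ite h1 hh₀ (Measurable.ite h2 key hh₀)
  convert this using 2 with p
  unfold certV
  split_ifs <;> rfl

/-- The result of a call is a measurable function of the starting point and the random points. -/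
theorem Valid.measurable_next :
    Measurable fun p : Vec d × (ℕ → Vec d) => A.next p.1 p.2 := by
  classical
  have hu := hA.measurable_certU
  have hp : Measurable fun p : Vec d × (ℕ → Vec d) =>
      (A.certU p.1 p.2, A.eig (hessian A.f (A.certU p.1 p.2))) :=
    hu.prodMk (hA.measurable_direction.comp hu)
  have hq (i) : Measurable fun p : Vec d × (ℕ → Vec d) =>
      A.exploitPair (A.certU p.1 p.2) (A.queries p.1 i).point :=
    hA.measurable_exploitPair.comp
      (f := fun p : Vec d × (ℕ → Vec d) => (A.certU p.1 p.2, (A.queries p.1 i).point))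
      (hu.prodMk ((hA.measurable_queries_point i).comp measurable_fst))
  unfold next finish
  refine Measurable.ite (measurableSet_le (hA.measurable_gradient.comp hu).norm measurable_const)
    (Measurable.ite (measurableSet_le measurable_const (hA.measurable_curvature.comp hu)) hu
      (hA.measurable_exploitNC.comp (f := fun p : Vec d × (ℕ → Vec d) =>
        (A.certU p.1 p.2, A.eig (hessian A.f (A.certU p.1 p.2)))) hp)) ?_
  have := hA.measurable_certV_elim
    (h := fun i p => A.exploitPair (A.certU p.1 p.2) (A.queries p.1 i).point)
    hq hu
  convert this using 2 with p
  cases A.certV p.1 p.2 <;> rfl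

/-! ### The probability of a rejection -/

theorem Valid.steps_pos : 0 < A.steps := by
  have h := hA.cutting.tau_pos
  have hd : (0 : ℝ) < d := by exact_mod_cast hA.dim_pos
  refine Nat.ceil_pos.2 (mul_pos (div_pos hd h) ?_)
  exact zero_lt_one.trans_le (le_max_left _ _)

/-- With `Y = 16 L̂ R / ε̂`, the number of steps gives `(1 - τ)^N ≤ exp (-τ N) ≤ Y^(-d)`, while the
ratio of the radii is `Y / 2`. The product is at most `2^(-d)`. -/
theorem Valid.pow_steps_le :
    (1 - A.τ) ^ A.steps * (A.R / (A.ε / 2 / (8 * A.smooth))) ^ d ≤ 1 / 2 := by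
  have hτ := hA.cutting.tau_pos
  have hτ' := hA.cutting.tau_le
  have hs := hA.smooth_pos
  have hε := hA.ε_pos
  have hR := hA.R_pos
  have hd : (0 : ℝ) < d := by exact_mod_cast hA.dim_pos
  set Y := 16 * A.smooth * A.R / (A.ε / 2) with hY
  have hY0 : 0 < Y := by positivity
  have hYR : A.R / (A.ε / 2 / (8 * A.smooth)) = Y / 2 := by
    rw [hY]
    field_simp
    norm_num
  have h1 : (d : ℝ) * Real.log Y ≤ A.τ * A.steps := by
    have h2 : (d / A.τ) * logPlus Y ≤ A.steps := Nat.le_ceil _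
    have h3 : (d / A.τ) * Real.log Y ≤ A.steps :=
      (mul_le_mul_of_nonneg_left (le_max_right _ _) (by positivity)).trans h2
    rw [div_mul_eq_mul_div, div_le_iff₀ hτ] at h3
    linarith
  have h2 : (1 - A.τ) ^ A.steps ≤ (Y ^ d)⁻¹ := by
    calc (1 - A.τ) ^ A.steps ≤ Real.exp (-A.τ) ^ A.steps :=
          pow_le_pow_left₀ (by linarith) (Real.one_sub_le_exp_neg _) _
      _ = Real.exp (-(A.τ * A.steps)) := by rw [← Real.exp_nat_mul]; ring_nf
      _ ≤ Real.exp (-(d * Real.log Y)) := Real.exp_le_exp.2 (by linarith)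
      _ = (Y ^ d)⁻¹ := by rw [Real.exp_neg, Real.exp_nat_mul, Real.exp_log hY0]
  rw [hYR, div_pow]
  calc (1 - A.τ) ^ A.steps * (Y ^ d / 2 ^ d) ≤ (Y ^ d)⁻¹ * (Y ^ d / 2 ^ d) := by gcongr
    _ = (1 / 2) ^ d := by
      rw [one_div, inv_pow]
      field_simp
    _ ≤ 1 / 2 := pow_le_of_le_one (by norm_num) (by norm_num) hA.dim_pos.ne'

/-- The candidate is the image of `x` under a translation composed with scaling by `r`, so pulling
the kept region back multiplies its volume by `r^(-d)`. -/
theorem Valid.volume_rejected_le (z : Vec d) :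
    volume {x | A.cand z x ∈ A.kept z} ≤
      ENNReal.ofReal (1 / 2) * volume (Metric.closedBall (0 : Vec d) 1) := by
  set r := A.ε / 2 / (8 * A.smooth) with hr
  have hr0 : 0 < r := by
    have := hA.ε_pos
    have := hA.smooth_pos
    positivity
  set y := (bestQuery (A.queries z)).point - (1 / A.smooth) • (bestQuery (A.queries z)).slope
  have h1 : {x | A.cand z x ∈ A.kept z} = (r • ·) ⁻¹' ((y + ·) ⁻¹' A.kept z) := rfl
  have hv := hA.cutting.volume_le (model A.f A.pen z) z A.R A.steps
    (differentiable_model hA.differentiable _ _) hA.R_pos hA.steps_pos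
  change volume (A.kept z) ≤ _ at hv
  have h2 : 0 ≤ (1 - A.τ) ^ A.steps :=
    pow_nonneg (by linarith [hA.cutting.tau_le]) _
  rw [h1, Measure.addHaar_preimage_smul _ hr0.ne', measure_preimage_add]
  rw [Measure.addHaar_closedBall' _ _ hA.R_pos.le] at hv
  refine (mul_le_mul_right hv _).trans ?_
  rw [← mul_assoc, ← mul_assoc]
  refine mul_le_mul_left ?_ _
  rw [finrank_euclideanSpace, Fintype.card_fin, ← ENNReal.ofReal_mul (abs_nonneg _),
    ← ENNReal.ofReal_mul (mul_nonneg (abs_nonneg _) h2)]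
  have h3 : (1 - A.τ) ^ A.steps * (A.R / r) ^ d ≤ 1 / 2 := hA.pow_steps_le
  clear_value r
  refine ENNReal.ofReal_le_ofReal (le_trans (le_of_eq ?_) h3)
  rw [abs_of_pos (inv_pos.2 (pow_pos hr0 d)), div_pow]
  ring

end Setup

/-! ### Independence of disjoint blocks of random points -/

section SigmaAlgebra

variable {Ω E : Type*} [mΩ : MeasurableSpace Ω] [mE : MeasurableSpace E] {ξ : ℕ → ℕ → Ω → E}
  {S T : Set (ℕ × ℕ)}

/-- The `σ`-algebra generated by the variables with index in `S`. -/
abbrev sigmaOn (ξ : ℕ → ℕ → Ω → E) (S : Set (ℕ × ℕ)) : MeasurableSpace Ω :=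
  ⨆ i ∈ S, mE.comap (ξ i.1 i.2)

omit mΩ in
theorem sigmaOn_mono (h : S ⊆ T) : sigmaOn ξ S ≤ sigmaOn ξ T := biSup_mono h

theorem sigmaOn_le (hξ : ∀ t k, Measurable (ξ t k)) (S : Set (ℕ × ℕ)) : sigmaOn ξ S ≤ mΩ :=
  iSup₂_le fun i _ => (hξ i.1 i.2).comap_le

omit mΩ in
theorem measurable_sigmaOn {t k : ℕ} (h : (t, k) ∈ S) : Measurable[sigmaOn ξ S] (ξ t k) :=
  (comap_measurable (ξ t k)).mono
    (le_biSup (fun i : ℕ × ℕ => mE.comap (ξ i.1 i.2)) h) le_rfl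

theorem indep_sigmaOn {Pr : Measure Ω} (hξ : ∀ t k, Measurable (ξ t k))
    (hi : iIndepFun (fun i : ℕ × ℕ => ξ i.1 i.2) Pr) (h : Disjoint S T) :
    Indep (sigmaOn ξ S) (sigmaOn ξ T) Pr :=
  indep_iSup_of_disjoint (m := fun i : ℕ × ℕ => mE.comap (ξ i.1 i.2))
    (fun i => (hξ i.1 i.2).comap_le) ((iIndepFun_iff_iIndep ..).1 hi) h

end SigmaAlgebra

namespace Setup

variable {d : ℕ} (A : Setup d)

/-! ### Exponential moments of the number of trials -/

/-- The set of pairs `(z, x)` such that the candidate generated from `x` is rejected in a call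
at `z`. -/
def rejected : Set (Vec d × Vec d) := {p | A.cand p.1 p.2 ∈ A.kept p.1}

/-- A series that dominates the exponential of a tenth of the number of trials, and is infinite
if all candidates are rejected. -/
noncomputable def wait (z : Vec d) (ξ : ℕ → Vec d) : ℝ≥0∞ :=
  ∑' k : ℕ, ENNReal.ofReal (Real.exp ((k + 1) / 10)) *
    ∏ j ∈ Finset.range k, A.rejected.indicator 1 (z, ξ j)

theorem exp_le_wait (z : Vec d) (ξ : ℕ → Vec d) :
    ENNReal.ofReal (Real.exp ((A.accepted z ξ + 1) / 10)) ≤ A.wait z ξ := by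
  refine le_trans (le_of_eq ?_) (ENNReal.le_tsum (A.accepted z ξ))
  rw [Finset.prod_eq_one, mul_one]
  intro j hj
  exact Set.indicator_of_mem
    (show (z, ξ j) ∈ A.rejected from
      mem_of_lt_firstOutside (u := fun k => A.cand z (ξ k)) (Finset.mem_range.1 hj)) _

theorem one_le_wait (z : Vec d) (ξ : ℕ → Vec d) : 1 ≤ A.wait z ξ := by
  refine le_trans ?_ (A.exp_le_wait z ξ)
  rw [ENNReal.one_le_ofReal]
  exact Real.one_le_exp (by positivity)

/-- If all candidates are rejected, every term of the series is at least `1`. -/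
theorem exists_accepted_of_wait_ne_top {z : Vec d} {ξ : ℕ → Vec d} (h : A.wait z ξ ≠ ⊤) :
    ∃ k, A.cand z (ξ k) ∉ A.kept z := by
  by_contra! hall
  refine h (top_le_iff.1 ?_)
  rw [← ENNReal.tsum_const_eq_top_of_ne_zero (α := ℕ) one_ne_zero]
  refine ENNReal.tsum_le_tsum fun k => ?_
  rw [Finset.prod_eq_one, mul_one, ENNReal.one_le_ofReal]
  · exact Real.one_le_exp (by positivity)
  · intro j _
    exact Set.indicator_of_mem (show (z, ξ j) ∈ A.rejected from hall j) _

/-- Since `exp (1/10) ≤ 5/4`, the series is dominated by a geometric one with ratio `5/8` and sum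
`10/3`. -/
theorem tsum_exp_mul_pow_le :
    ∑' k : ℕ, ENNReal.ofReal (Real.exp ((k + 1) / 10)) * ENNReal.ofReal (1 / 2) ^ k ≤ 4 := by
  have he : Real.exp (1 / 10) ≤ 5 / 4 := by
    have h := Real.one_sub_le_exp_neg (1 / 10)
    rw [Real.exp_neg, le_inv_comm₀ (by norm_num) (Real.exp_pos _)] at h
    exact h.trans (by norm_num)
  have h1 : ∀ k : ℕ, ENNReal.ofReal (Real.exp ((k + 1) / 10)) * ENNReal.ofReal (1 / 2) ^ k ≤
      ENNReal.ofReal (5 / 4 * (5 / 8) ^ k) := fun k => by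
    rw [← ENNReal.ofReal_pow (by norm_num), ← ENNReal.ofReal_mul (Real.exp_pos _).le]
    refine ENNReal.ofReal_le_ofReal ?_
    have h2 : Real.exp ((k + 1) / 10) = Real.exp (1 / 10) ^ (k + 1) := by
      rw [← Real.exp_nat_mul]
      push_cast
      ring_nf
    have h3 := pow_le_pow_left₀ (Real.exp_pos _).le he (k + 1)
    calc Real.exp ((k + 1) / 10) * (1 / 2) ^ k ≤ (5 / 4) ^ (k + 1) * (1 / 2) ^ k := by
          rw [h2]
          gcongr
      _ = 5 / 4 * (5 / 4 * (1 / 2)) ^ k := by rw [mul_pow]; ring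
      _ = 5 / 4 * (5 / 8) ^ k := by norm_num
  refine (ENNReal.tsum_le_tsum h1).trans ?_
  have hs : Summable fun k : ℕ => (5 / 4 : ℝ) * (5 / 8) ^ k :=
    (summable_geometric_of_lt_one (by norm_num) (by norm_num)).mul_left _
  rw [← ENNReal.ofReal_tsum_of_nonneg (fun k => by positivity) hs, tsum_mul_left,
    tsum_geometric_of_lt_one (by norm_num) (by norm_num)]
  refine ENNReal.ofReal_le_of_le_toReal ?_
  norm_num

section Probability

variable {A} (hA : A.Valid) {Ω : Type*} [MeasurableSpace Ω] {Pr : Measure Ω}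
  [IsProbabilityMeasure Pr]
include hA

theorem Valid.measurable_wait :
    Measurable fun p : Vec d × (ℕ → Vec d) => A.wait p.1 p.2 := by
  refine Measurable.tsum fun k => Measurable.const_mul ?_ _
  refine Finset.measurable_prod _ fun j _ => ?_
  exact ((measurable_const (a := (1 : ℝ≥0∞))).indicator hA.measurableSet_rejected).comp
    (f := fun p : Vec d × (ℕ → Vec d) => (p.1, p.2 j))
    (measurable_fst.prodMk ((measurable_pi_apply j).comp measurable_snd))

omit [IsProbabilityMeasure Pr] in
theorem Valid.measure_rejected_le {X : Ω → Vec d} (hX : Measurable X)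
    (hu : pdf.IsUniform X (Metric.closedBall 0 1) Pr volume) (z : Vec d) :
    Pr (X ⁻¹' {x | (z, x) ∈ A.rejected}) ≤ ENNReal.ofReal (1 / 2) := by
  have hB : MeasurableSet {x | (z, x) ∈ A.rejected} :=
    measurable_prodMk_left hA.measurableSet_rejected
  have hV0 : volume (Metric.closedBall (0 : Vec d) 1) ≠ 0 :=
    (Metric.measure_closedBall_pos volume 0 one_pos).ne'
  have hVt : volume (Metric.closedBall (0 : Vec d) 1) ≠ ⊤ :=
    (isCompact_closedBall (0 : Vec d) 1).measure_lt_top.ne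
  rw [← Measure.map_apply hX hB, hu, cond_apply Metric.isClosed_closedBall.measurableSet]
  calc _ ≤ (volume (Metric.closedBall (0 : Vec d) 1))⁻¹ *
        (ENNReal.ofReal (1 / 2) * volume (Metric.closedBall (0 : Vec d) 1)) := by
        gcongr
        exact (measure_mono Set.inter_subset_right).trans (hA.volume_rejected_le z)
    _ = ENNReal.ofReal (1 / 2) := by
        rw [mul_comm, mul_assoc, ENNReal.mul_inv_cancel hV0 hVt, mul_one]

omit [IsProbabilityMeasure Pr] in
-- For fixed `z` the product in the `k`-th term is the indicator of rejecting the first `k`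
-- candidates, an event of probability at most `2^(-k)` by independence.
theorem Valid.lintegral_wait_le {X : ℕ → Ω → Vec d} (hX : ∀ k, Measurable (X k))
    (hu : ∀ k, pdf.IsUniform (X k) (Metric.closedBall 0 1) Pr volume) (hi : iIndepFun X Pr)
    (z : Vec d) : ∫⁻ w, A.wait z (fun k => X k w) ∂Pr ≤ 4 := by
  have hB : MeasurableSet {x | (z, x) ∈ A.rejected} :=
    measurable_prodMk_left hA.measurableSet_rejected
  have hprod : ∀ (k : ℕ) w, ∏ j ∈ Finset.range k, A.rejected.indicator (1 : Vec d × Vec d → ℝ≥0∞) (z, X j w) =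
      (⋂ j ∈ Finset.range k, X j ⁻¹' {x | (z, x) ∈ A.rejected}).indicator 1 w := by
    intro k w
    classical
    by_cases h : ∀ j ∈ Finset.range k, (z, X j w) ∈ A.rejected
    · rw [Set.indicator_of_mem (by simpa using h), Finset.prod_eq_one]
      · rfl
      · exact fun j hj => Set.indicator_of_mem (h j hj) _
    · rw [Set.indicator_of_notMem (by simpa using h)]
      push Not at h
      obtain ⟨j, hj, h⟩ := h
      exact Finset.prod_eq_zero hj (Set.indicator_of_notMem h _)
  have hm : ∀ k : ℕ, MeasurableSet (⋂ j ∈ Finset.range k, X j ⁻¹' {x | (z, x) ∈ A.rejected}) :=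
    fun k => Finset.measurableSet_biInter _ fun j _ => hX j hB
  unfold wait
  simp_rw [hprod]
  rw [lintegral_tsum fun k => ((measurable_one.indicator (hm k)).const_mul _).aemeasurable]
  refine le_trans (ENNReal.tsum_le_tsum fun k => ?_) tsum_exp_mul_pow_le
  rw [lintegral_const_mul _ (measurable_one.indicator (hm k)), lintegral_indicator_one (hm k),
    hi.measure_inter_preimage_eq_mul (Finset.range k) (fun _ _ => hB)]
  gcongr
  refine (Finset.prod_le_pow_card _ _ _ fun j _ => hA.measure_rejected_le (hX j) (hu j) z).trans ?_
  rw [Finset.card_range]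

/-! ### The sequence of calls -/

omit hA in
/-- The sequence of iterates. -/
noncomputable def iter (A : Setup d) (z₀ : Vec d) (ξ : ℕ → ℕ → Vec d) : ℕ → Vec d
  | 0 => z₀
  | n + 1 => A.next (iter A z₀ ξ n) (ξ n)

omit hA in
/-- The product of the waiting factors of the first `n` calls. -/
noncomputable def waits (A : Setup d) (z₀ : Vec d) (ξ : ℕ → ℕ → Vec d) (n : ℕ) : ℝ≥0∞ :=
  ∏ t ∈ Finset.range n, A.wait (A.iter z₀ ξ t) (ξ t)

omit [MeasurableSpace Ω] in
/-- The iterates and waiting factors are adapted. -/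
theorem Valid.measurable_iter_waits (z₀ : Vec d) {ξ : ℕ → ℕ → Ω → Vec d}
    {F : ℕ → MeasurableSpace Ω} (hF : Monotone F)
    (hξ : ∀ t k, Measurable[F (t + 1)] (ξ t k)) (n : ℕ) :
    Measurable[F n] (fun w => A.iter z₀ (fun t k => ξ t k w) n) ∧
      Measurable[F n] (fun w => A.waits z₀ (fun t k => ξ t k w) n) := by
  induction n with
  | zero => exact ⟨measurable_const, by simp [waits]⟩
  | succ n ih =>
    have h1 := ih.1.mono (hF n.le_succ) le_rfl
    have h2 := ih.2.mono (hF n.le_succ) le_rfl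
    have h3 : Measurable[F (n + 1)] fun w k => ξ n k w :=
      @measurable_pi_lambda _ _ _ (F (n + 1)) _ _ (hξ n)
    have h4 : Measurable[F (n + 1)] fun w =>
      (A.iter z₀ (fun t k => ξ t k w) n, fun k => ξ n k w) := h1.prodMk h3
    have h5 : Measurable[F (n + 1)] fun w =>
        A.next (A.iter z₀ (fun t k => ξ t k w) n) (fun k => ξ n k w) :=
      hA.measurable_next.comp (f := fun w => (A.iter z₀ (fun t k => ξ t k w) n, fun k => ξ n k w)) h4
    have h6 : Measurable[F (n + 1)] fun w =>
        A.wait (A.iter z₀ (fun t k => ξ t k w) n) (fun k => ξ n k w) :=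
      hA.measurable_wait.comp (f := fun w => (A.iter z₀ (fun t k => ξ t k w) n, fun k => ξ n k w)) h4
    refine ⟨h5, ?_⟩
    simp only [waits, Finset.prod_range_succ]
    exact h2.mul h6

/-- The iterate and the product after `n` calls depend only on the random points of those calls,
which are independent of those of call `n`. By Tonelli the new factor may be integrated first with
the iterate frozen, and contributes at most `4`. -/
theorem Valid.lintegral_waits_le (z₀ : Vec d) {ξ : ℕ → ℕ → Ω → Vec d}
    (hξ : ∀ t k, Measurable (ξ t k))
    (hu : ∀ t k, pdf.IsUniform (ξ t k) (Metric.closedBall 0 1) Pr volume)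
    (hi : iIndepFun (fun i : ℕ × ℕ => ξ i.1 i.2) Pr) (n : ℕ) :
    ∫⁻ w, A.waits z₀ (fun t k => ξ t k w) n ∂Pr ≤ 4 ^ n := by
  induction n with
  | zero => simp [waits]
  | succ n ih =>
    obtain ⟨m1, m2⟩ := hA.measurable_iter_waits z₀
      (F := fun n => sigmaOn ξ {i | i.1 < n})
      (fun m n hmn => sigmaOn_mono fun i (hi : i.1 < m) => lt_of_lt_of_le hi hmn)
      (fun t k => measurable_sigmaOn (Nat.lt_succ_self t)) n
    have mX := m1.prodMk m2
    have hX : Measurable fun w => (A.iter z₀ (fun t k => ξ t k w) n,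
        A.waits z₀ (fun t k => ξ t k w) n) := mX.mono (sigmaOn_le hξ _) le_rfl
    have hW : Measurable fun w k => ξ n k w := measurable_pi_lambda _ (hξ n)
    have hXW : IndepFun (fun w => (A.iter z₀ (fun t k => ξ t k w) n,
        A.waits z₀ (fun t k => ξ t k w) n)) (fun w k => ξ n k w) Pr := by
      rw [IndepFun_iff_Indep]
      have hW' : Measurable[sigmaOn ξ {i | i.1 = n}] fun w k => ξ n k w :=
        @measurable_pi_lambda _ _ _ (sigmaOn ξ {i | i.1 = n}) _ _ fun k =>
          measurable_sigmaOn (S := {i | i.1 = n}) rfl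
      refine indep_of_indep_of_le_left (indep_of_indep_of_le_right
        (indep_sigmaOn hξ hi ?_) hW'.comap_le) mX.comap_le
      rw [Set.disjoint_left]
      intro i (h1 : i.1 < n) (h2 : i.1 = n)
      exact h1.ne h2
    rw [indepFun_iff_map_prod_eq_prod_map_map hX.aemeasurable hW.aemeasurable] at hXW
    set X := fun w => (A.iter z₀ (fun t k => ξ t k w) n, A.waits z₀ (fun t k => ξ t k w) n)
    set W := fun w k => ξ n k w with hWdef
    have hh : Measurable fun p : (Vec d × ℝ≥0∞) × (ℕ → Vec d) => p.1.2 * A.wait p.1.1 p.2 :=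
      measurable_fst.snd.mul (hA.measurable_wait.comp
        (f := fun p : (Vec d × ℝ≥0∞) × (ℕ → Vec d) => (p.1.1, p.2))
        (measurable_fst.fst.prodMk measurable_snd))
    have hwz : ∀ z : Vec d, Measurable fun v : ℕ → Vec d => A.wait z v := fun z =>
      hA.measurable_wait.comp (f := fun v : ℕ → Vec d => (z, v)) (by fun_prop)
    have : IsProbabilityMeasure (Pr.map W) := Measure.isProbabilityMeasure_map hW.aemeasurable
    calc ∫⁻ w, A.waits z₀ (fun t k => ξ t k w) (n + 1) ∂Pr
        = ∫⁻ w, (fun p : (Vec d × ℝ≥0∞) × (ℕ → Vec d) => p.1.2 * A.wait p.1.1 p.2) (X w, W w) ∂Pr := by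
          refine lintegral_congr fun w => ?_
          rw [waits, Finset.prod_range_succ]
          rfl
      _ = ∫⁻ x, ∫⁻ v, x.2 * A.wait x.1 v ∂(Pr.map W) ∂(Pr.map X) := by
          rw [← lintegral_map hh (hX.prodMk hW), hXW, lintegral_prod _ hh.aemeasurable]
      _ ≤ ∫⁻ x, x.2 * 4 ∂(Pr.map X) := by
          refine lintegral_mono fun x => ?_
          dsimp only
          rw [lintegral_const_mul _ (hwz x.1), lintegral_map (hwz x.1) hW]
          gcongr
          refine hA.lintegral_wait_le (hξ n) (hu n) ?_ x.1
          exact hi.precomp (g := fun k => (n, k)) (fun _ _ h => (Prod.ext_iff.1 h).2)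
      _ = (∫⁻ w, A.waits z₀ (fun t k => ξ t k w) n ∂Pr) * 4 := by
          rw [lintegral_mul_const _ measurable_snd, lintegral_map measurable_snd hX]
      _ ≤ 4 ^ n * 4 := by gcongr
      _ = 4 ^ (n + 1) := (pow_succ _ _).symm

omit hA in
-- In `ℝ≥0∞` a zero factor could hide an infinite one; here all factors are at least `1`.
theorem waits_ne_top_iff (z₀ : Vec d) (ξ : ℕ → ℕ → Vec d) (n : ℕ) (h : A.waits z₀ ξ n ≠ ⊤) :
    ∀ t < n, A.wait (A.iter z₀ ξ t) (ξ t) ≠ ⊤ := by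
  intro t ht htop
  refine h ?_
  rw [waits, ← Finset.mul_prod_erase _ _ (Finset.mem_range.2 ht), htop]
  refine ENNReal.top_mul (Finset.prod_ne_zero_iff.2 fun i _ => ?_)
  exact (zero_lt_one.trans_le (A.one_le_wait _ _)).ne'

omit hA in
/-- The number of random points used in the first `n` calls. -/
noncomputable def trials (A : Setup d) (z₀ : Vec d) (ξ : ℕ → ℕ → Vec d) (n : ℕ) : ℕ :=
  ∑ t ∈ Finset.range n, (A.accepted (A.iter z₀ ξ t) (ξ t) + 1)

omit hA in
theorem exp_trials_le_waits (z₀ : Vec d) (ξ : ℕ → ℕ → Vec d) (n : ℕ) :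
    ENNReal.ofReal (Real.exp (A.trials z₀ ξ n / 10)) ≤ A.waits z₀ ξ n := by
  unfold trials waits
  push_cast
  rw [Finset.sum_div, Real.exp_sum, ENNReal.ofReal_prod_of_nonneg fun _ _ => (Real.exp_pos _).le]
  exact Finset.prod_le_prod' fun t _ => A.exp_le_wait _ _

/-- The random variable that controls the number of trials. -/
theorem Valid.exists_trials_bound (z₀ : Vec d) {ξ : ℕ → ℕ → Ω → Vec d}
    (hξ : ∀ t k, Measurable (ξ t k))
    (hu : ∀ t k, pdf.IsUniform (ξ t k) (Metric.closedBall 0 1) Pr volume)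
    (hi : iIndepFun (fun i : ℕ × ℕ => ξ i.1 i.2) Pr) {n : ℕ} (hn : 0 < n) :
    ∃ Kbar : Ω → ℝ, Measurable Kbar ∧ (∀ w, 0 < Kbar w) ∧
      (∀ y : ℝ, Pr.real {w | y ≤ Kbar w} ≤ Real.exp ((1 - y) / 10)) ∧
      ∀ᵐ w ∂Pr, (∀ t < n, ∃ k, A.cand (A.iter z₀ (fun t k => ξ t k w) t) (ξ t k w) ∉
          A.kept (A.iter z₀ (fun t k => ξ t k w) t)) ∧
        (A.trials z₀ (fun t k => ξ t k w) n : ℝ) ≤ 40 * n * Kbar w := by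
  set Y : Ω → ℝ≥0∞ := fun w => A.waits z₀ (fun t k => ξ t k w) n with hY
  have hn1 : (1 : ℝ) ≤ n := by exact_mod_cast hn
  have hYm : Measurable Y :=
    -- The constant filtration gives measurability with respect to the ambient `σ`-algebra.
    (hA.measurable_iter_waits z₀ (F := fun _ => inferInstance) monotone_const hξ n).2
  have hYi : ∫⁻ w, Y w ∂Pr ≤ 4 ^ n := hA.lintegral_waits_le z₀ hξ hu hi n
  -- The draws number at most `10 log Y`, hence at most `40 n` times this variable. Where `Y = ⊤`, a
  -- null set, it takes the value `1`.
  refine ⟨fun w => max 1 (Real.log (Y w).toReal / (4 * n)), ?_, ?_, ?_, ?_⟩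
  · exact measurable_const.max ((Real.measurable_log.comp hYm.ennreal_toReal).div_const _)
  · exact fun w => zero_lt_one.trans_le (le_max_left _ _)
  · intro y
    rcases le_or_gt y 1 with hy | hy
    · exact measureReal_le_one.trans (Real.one_le_exp (by linarith))
    refine ENNReal.toReal_le_of_le_ofReal (Real.exp_pos _).le ?_
    have hsub : {w | y ≤ max 1 (Real.log (Y w).toReal / (4 * n))} ⊆
        {w | ENNReal.ofReal (Real.exp (4 * n * y)) ≤ Y w} := by
      intro w hw
      have h1 : y ≤ Real.log (Y w).toReal / (4 * n) :=
        (le_max_iff.1 hw).resolve_left (not_le.2 hy)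
      rw [le_div_iff₀ (by positivity)] at h1
      have h2 : 0 < Real.log (Y w).toReal := lt_of_lt_of_le (by positivity) h1
      have h3 : 0 < (Y w).toReal := by
        refine lt_of_le_of_ne ENNReal.toReal_nonneg fun h => ?_
        rw [← h, Real.log_zero] at h2
        exact h2.false
      refine (ENNReal.ofReal_le_ofReal ?_).trans ENNReal.ofReal_toReal_le
      rw [← Real.le_log_iff_exp_le h3]
      linarith
    refine (measure_mono hsub).trans ?_
    refine (meas_ge_le_lintegral_div hYm.aemeasurable (by simp [Real.exp_pos]) (by simp)).trans ?_
    refine (ENNReal.div_le_div_right hYi _).trans ?_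
    have h4 : (4 : ℝ≥0∞) ^ n = ENNReal.ofReal (4 ^ n) := by
      rw [ENNReal.ofReal_pow (by norm_num)]
      norm_num
    rw [h4, ← ENNReal.ofReal_div_of_pos (Real.exp_pos _)]
    refine ENNReal.ofReal_le_ofReal ?_
    have h5 : (4 : ℝ) ≤ Real.exp 2 := by
      have := Real.add_one_le_exp (1 : ℝ)
      have h6 : Real.exp 2 = Real.exp 1 ^ 2 := by
        rw [← Real.exp_nat_mul]
        norm_num
      rw [h6]
      nlinarith
    have h7 : (4 : ℝ) ^ n ≤ Real.exp (n * 2) := by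
      rw [Real.exp_nat_mul]
      gcongr
    rw [div_le_iff₀ (Real.exp_pos _), ← Real.exp_add]
    refine h7.trans (Real.exp_le_exp.2 ?_)
    -- The exponents satisfy `2n - 4ny ≤ (1 - y)/10` because `y > 1` and `n ≥ 1`.
    nlinarith
  · have hfin : ∀ᵐ w ∂Pr, Y w < ⊤ := ae_lt_top hYm (hYi.trans_lt (by finiteness)).ne
    filter_upwards [hfin] with w hw
    refine ⟨fun t ht => A.exists_accepted_of_wait_ne_top
      (waits_ne_top_iff z₀ _ n hw.ne t ht), ?_⟩
    have h1 := exp_trials_le_waits (A := A) z₀ (fun t k => ξ t k w) n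
    have h2 := (ENNReal.ofReal_le_iff_le_toReal hw.ne).1 h1
    rw [← Real.le_log_iff_exp_le ((Real.exp_pos _).trans_le h2)] at h2
    have h3 : Real.log (Y w).toReal ≤ max 1 (Real.log (Y w).toReal / (4 * n)) * (4 * n) := by
      rw [← div_le_iff₀ (by positivity)]
      exact le_max_right _ _
    change _ ≤ Real.log (Y w).toReal at h2
    linarith

end Probability

theorem ae_norm_le_one {Ω : Type*} [MeasurableSpace Ω] {Pr : Measure Ω} {X : Ω → Vec d}
    (hX : Measurable X) (hu : pdf.IsUniform X (Metric.closedBall 0 1) Pr volume) :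
    ∀ᵐ w ∂Pr, ‖X w‖ ≤ 1 := by
  have hm : MeasurableSet (Metric.closedBall (0 : Vec d) 1)ᶜ :=
    Metric.isClosed_closedBall.measurableSet.compl
  have h : Pr (X ⁻¹' (Metric.closedBall (0 : Vec d) 1)ᶜ) = 0 := by
    rw [← Measure.map_apply hX hm, hu, cond_apply Metric.isClosed_closedBall.measurableSet]
    simp
  filter_upwards [compl_mem_ae_iff.2 h] with w hw
  simpa using hw

end Setup

namespace Setup

variable {d : ℕ} (A : Setup d)

/-! ### The run of the whole procedure -/

theorem repeatedCalls_succ (P : Prices) (centre : Set (Vec d) → Vec d) (e : Vec d) (τ : ℝ)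
    (eig : (Vec d →L[ℝ] Vec d) → Vec d) (f : Vec d → ℝ) (z₀ : Vec d) (ε L₁ L₃ R : ℝ)
    (ξ : ℕ → ℕ → Vec d) (n : ℕ) :
    repeatedCalls P centre e τ eig f z₀ ε L₁ L₃ R ξ (n + 1) =
      (repeatedCalls P centre e τ eig f z₀ ε L₁ L₃ R ξ n >>= fun z =>
        cuttingTrustRegion P centre e τ eig f z ε L₁ L₃ R (ξ n) >>= fun p =>
          charge (P.T2 + P.svd d + 2 * P.vec d) p.1) := by
  refine (?_ : (do
    let z ← repeatedCalls P centre e τ eig f z₀ ε L₁ L₃ R ξ n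
    let (zplus, _) ← cuttingTrustRegion P centre e τ eig f z ε L₁ L₃ R (ξ n)
    charge (P.T2 + P.svd d + 2 * P.vec d) zplus) = _)
  refine congrArg (bind _) (funext fun z => ?_)
  refine congrArg (bind _) (funext fun p => ?_)
  obtain ⟨a, b⟩ := p
  rfl

/-- The first `n` calls, with the prices of the tests. -/
noncomputable def run (z₀ : Vec d) (ξ : ℕ → ℕ → Vec d) (n : ℕ) : Timed (Vec d) :=
  repeatedCalls A.P A.centre A.e A.τ A.eig A.f z₀ A.ε A.L₁ A.L₃ A.R ξ n

theorem run_succ (z₀ : Vec d) (ξ : ℕ → ℕ → Vec d) (n : ℕ) :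
    A.run z₀ ξ (n + 1) = (A.run z₀ ξ n >>= fun z => A.call z (ξ n) >>= fun p =>
      charge (A.P.T2 + A.P.svd d + 2 * A.P.vec d) p.1) := by
  unfold run call
  exact repeatedCalls_succ ..

theorem run_succ_val (z₀ : Vec d) (ξ : ℕ → ℕ → Vec d) (n : ℕ) :
    (A.run z₀ ξ (n + 1)).val = (A.call (A.run z₀ ξ n).val (ξ n)).val.1 := by
  rw [run_succ]
  rfl

theorem run_succ_time (z₀ : Vec d) (ξ : ℕ → ℕ → Vec d) (n : ℕ) :
    (A.run z₀ ξ (n + 1)).time = (A.run z₀ ξ n).time + ((A.call (A.run z₀ ξ n).val (ξ n)).time +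
      ((A.P.T2 + A.P.svd d + 2 * A.P.vec d : ℝ≥0) : ℝ≥0∞)) := by
  rw [run_succ]
  rfl

theorem run_val (z₀ : Vec d) (ξ : ℕ → ℕ → Vec d) (n : ℕ) :
    (A.run z₀ ξ n).val = A.iter z₀ ξ n := by
  induction n with
  | zero => rfl
  | succ n ih =>
    rw [run_succ_val, call_fst, ih]
    rfl

/-- A bound on the price of a call and a test, apart from the random trials. -/
noncomputable def callPrice : ℝ≥0 :=
  (A.steps + 7) * (A.P.T1 + 12 * A.P.vec d) + A.steps * A.P.TC + 2 * A.P.T2 + 3 * A.P.svd d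

/-- `callPrice` covers a call and the test after it; the extra unit in `n + 1` pays for the test at
`z₀`. -/
theorem run_time_le (z₀ : Vec d) (ξ : ℕ → ℕ → Vec d) (n : ℕ)
    (h : ∀ t < n, ∃ k, A.cand (A.iter z₀ ξ t) (ξ t k) ∉ A.kept (A.iter z₀ ξ t)) :
    (A.run z₀ ξ n).time ≤
      (((n + 1) * A.callPrice + A.trials z₀ ξ n * ((2 * A.steps + 7) * A.P.vec d) : ℝ≥0) : ℝ≥0∞) := by
  have hv := (A.P.vec d).2
  have hs := (A.P.svd d).2
  have h1 := A.P.T1.2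
  have h2 := A.P.T2.2
  have hC := A.P.TC.2
  have hvs : (0 : ℝ) ≤ A.steps * A.P.vec d := by positivity
  have hts : (0 : ℝ) ≤ A.steps * A.P.T1 := by positivity
  have hcs : (0 : ℝ) ≤ A.steps * A.P.TC := by positivity
  induction n with
  | zero =>
    change ((A.P.T2 + A.P.svd d + 2 * A.P.vec d : ℝ≥0) : ℝ≥0∞) ≤ _
    rw [ENNReal.coe_le_coe, ← NNReal.coe_le_coe]
    simp only [callPrice, trials]
    push_cast
    simp only [Finset.range_zero, Finset.sum_empty]
    linarith
  | succ n ih =>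
    have e1 := ih fun t ht => h t (ht.trans n.lt_succ_self)
    have e2 := A.call_time (A.iter z₀ ξ n) (ξ n) (h n n.lt_succ_self)
    rw [run_succ_time, run_val]
    refine (add_le_add e1 (add_le_add e2 le_rfl)).trans ?_
    simp only [← ENNReal.coe_add, ENNReal.coe_le_coe]
    rw [← NNReal.coe_le_coe]
    simp only [callPrice, trials, Finset.sum_range_succ]
    push_cast
    linarith

/-- The guaranteed decrease in a call that does not find an approximate stationary point. -/
noncomputable def decrease : ℝ := min (A.ε ^ 2 / (8 * A.pen)) (10 * A.L₃ * A.R ^ 4)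

theorem Valid.decrease_pos {A : Setup d} (hA : A.Valid) : 0 < A.decrease := by
  have := hA.pen_pos
  have := hA.ε_pos
  have := hA.L₃_pos
  have := hA.R_pos
  exact lt_min (by positivity) (by positivity)

theorem Valid.exists_stationary {A : Setup d} (hA : A.Valid) {z₀ : Vec d} {ξ : ℕ → ℕ → Vec d}
    {n : ℕ} {Δ : ℝ} (hb : BddBelow (Set.range A.f)) (hΔ : A.f z₀ - ⨅ x, A.f x ≤ Δ)
    (hn : Δ < n * A.decrease) (hξ : ∀ t k, ‖ξ t k‖ ≤ 1)
    (h : ∀ t < n, ∃ k, A.cand (A.iter z₀ ξ t) (ξ t k) ∉ A.kept (A.iter z₀ ξ t)) :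
    ∃ m ≤ n, IsApproxStationary A.f A.ε A.pen (A.iter z₀ ξ m) := by
  by_contra! hno
  have key : ∀ t ≤ n, A.f (A.iter z₀ ξ t) ≤ A.f z₀ - t * A.decrease := by
    intro t
    induction t with
    | zero => intro _; simp [iter]
    | succ t ih =>
      intro ht
      have h1 := ih (Nat.le_of_succ_le ht)
      have h2 := (hA.next_progress (A.iter z₀ ξ t) (hξ t) (h t ht)).resolve_left (hno (t + 1) ht)
      change A.f (A.next (A.iter z₀ ξ t) (ξ t)) ≤ _
      have h3 : A.f (A.next (A.iter z₀ ξ t) (ξ t)) ≤ A.f (A.iter z₀ ξ t) - A.decrease := h2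
      push_cast
      linarith
  have h1 := key n le_rfl
  have h2 := ciInf_le hb (A.iter z₀ ξ n)
  linarith

end Setup

/-! ### Real estimates -/

theorem one_le_logPlus (x : ℝ) : 1 ≤ logPlus x := le_max_left _ _

/-- The argument is at most `M * max 1 x`. As `logPlus` is at least `1`, the additive constant `log
M` can be absorbed into a factor. -/
theorem logPlus_affine_le {ρ x : ℝ} (hρ : 0 < ρ) (hx : 0 < x) :
    logPlus (32 * ρ * x + 672 * ρ ^ 3) ≤
      (1 + |Real.log (32 * ρ + 672 * ρ ^ 3)|) * logPlus (x ^ 3) := by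
  set M := 32 * ρ + 672 * ρ ^ 3 with hM
  have hM0 : 0 < M := by positivity
  have h1 := one_le_logPlus (x ^ 3)
  have hm : 0 < max 1 x := lt_max_of_lt_left one_pos
  have h2 : Real.log (max 1 x) ≤ logPlus (x ^ 3) := by
    rcases le_total x 1 with h | h
    · rw [max_eq_left h, Real.log_one]
      linarith
    · rw [max_eq_right h]
      refine le_trans ?_ (le_max_right _ _)
      rw [Real.log_pow]
      have := Real.log_nonneg h
      push_cast
      linarith
  have h3 : 32 * ρ * x + 672 * ρ ^ 3 ≤ M * max 1 x := by
    have e1 : 32 * ρ * x ≤ 32 * ρ * max 1 x := by gcongr; exact le_max_right _ _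
    have e2 : 672 * ρ ^ 3 * 1 ≤ 672 * ρ ^ 3 * max 1 x := by gcongr; exact le_max_left _ _
    rw [hM]
    linarith
  have h4 : Real.log (32 * ρ * x + 672 * ρ ^ 3) ≤ Real.log M + Real.log (max 1 x) := by
    rw [← Real.log_mul hM0.ne' hm.ne']
    exact Real.log_le_log (by positivity) h3
  have h5 := le_abs_self (Real.log M)
  have h6 : |Real.log M| * 1 ≤ |Real.log M| * logPlus (x ^ 3) := by gcongr
  have h7 := abs_nonneg (Real.log M)
  refine max_le ?_ ?_ <;> linarith

/-- The total price in terms of the parameters of the problem. -/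
theorem total_price_le {n K d c ω T1 T2 TC q N C₁ ℓ t : ℝ} (hn : 0 ≤ n) (hK : 0 ≤ K)
    (hd : 0 ≤ d) (hc : 0 ≤ c) (hT1 : 0 ≤ T1) (hT2 : 0 ≤ T2) (hTC : 0 ≤ TC) (_ : 0 ≤ d ^ ω)
    (hC₁ : 1 ≤ C₁) (hq : 1 ≤ q) (hℓ : 1 ≤ ℓ) (hdT : d ≤ c * T1) (hN : N ≤ 2 * (C₁ * q * ℓ))
    (ht0 : 0 ≤ t) (ht : t ≤ 40 * n * K) :
    (n + 1) * ((N + 7) * (T1 + 12 * (c * d)) + N * TC + 2 * T2 + 3 * (c * d ^ ω)) +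
        t * ((2 * N + 7) * (c * d)) ≤
      (n + 1) * ((9 * (1 + 12 * c ^ 2) + 2 + 443 * c) * C₁ *
        ((TC + T1 + K * d) * q * ℓ + T2 + d ^ ω)) := by
  -- Since `N ≤ 2s` and `s ≥ 1`, one has `N + 7 ≤ 9s` and `2N + 7 ≤ 11s`.
  set s := C₁ * q * ℓ with hs
  have hs1 : 1 ≤ s := by
    have := one_le_mul_of_one_le_of_one_le hC₁ hq
    exact one_le_mul_of_one_le_of_one_le this hℓ
  have hcd : c * d ≤ c ^ 2 * T1 := by nlinarith
  have hcd0 : 0 ≤ c * d := by positivity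
  have a1 : (N + 7) * (T1 + 12 * (c * d)) ≤ 9 * s * ((1 + 12 * c ^ 2) * T1) := by
    calc (N + 7) * (T1 + 12 * (c * d)) ≤ 9 * s * (T1 + 12 * (c * d)) := by
          gcongr
          linarith
      _ ≤ 9 * s * ((1 + 12 * c ^ 2) * T1) := by
          gcongr
          linarith
  have a2 : N * TC ≤ 2 * s * TC := by gcongr
  have a3 : t * ((2 * N + 7) * (c * d)) ≤ 40 * n * K * (11 * s * (c * d)) := by
    calc t * ((2 * N + 7) * (c * d)) ≤ t * (11 * s * (c * d)) := by
          gcongr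
          linarith
      _ ≤ 40 * n * K * (11 * s * (c * d)) := by gcongr
  have a4 : 40 * n * K * (11 * s * (c * d)) ≤ (n + 1) * (440 * c * (s * (K * d))) := by
    have : 0 ≤ 440 * c * (s * (K * d)) := by positivity
    linarith
  have b1 : 0 ≤ s * T1 := by positivity
  have b2 : 0 ≤ s * TC := by positivity
  have b3 : 0 ≤ s * (K * d) := by positivity
  have hcc : 0 ≤ c ^ 2 := sq_nonneg c
  -- The summands cover the coefficients of `T1`, of `TC` and `T2`, and, as `443 = 440 + 3`, of the
  -- random draws and the decompositions.
  set E := 9 * (1 + 12 * c ^ 2) + 2 + 443 * c with hE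
  have e1 : 9 * (1 + 12 * c ^ 2) * (s * T1) ≤ E * (s * T1) := by gcongr; linarith
  have e2 : 2 * (s * TC) ≤ E * (s * TC) := by gcongr; linarith
  have e3 : 440 * c * (s * (K * d)) ≤ E * (s * (K * d)) := by gcongr; linarith
  have e4 : 2 * T2 ≤ E * T2 := by gcongr; linarith
  have e5 : 3 * c * d ^ ω ≤ E * d ^ ω := by gcongr; linarith
  have hE0 : 0 ≤ E := by positivity
  have e6 : E * T2 ≤ C₁ * (E * T2) := le_mul_of_one_le_left (by positivity) hC₁
  have e7 : E * d ^ ω ≤ C₁ * (E * d ^ ω) := le_mul_of_one_le_left (by positivity) hC₁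
  refine (add_le_add le_rfl (a3.trans a4)).trans ?_
  rw [← mul_add]
  refine mul_le_mul_of_nonneg_left ?_ (by linarith)
  have : E * C₁ * ((TC + T1 + K * d) * q * ℓ + T2 + d ^ ω) =
      E * (s * TC) + E * (s * T1) + E * (s * (K * d)) + C₁ * (E * T2) + C₁ * (E * d ^ ω) := by
    rw [hs]
    ring
  rw [this]
  linarith

/-! ### Scaling with the radius `ρ L₃^(-1/3) ε^(1/3)` -/

namespace Setup

variable {d : ℕ}

/-- The procedure with trust region radius `ρ L₃^(-1/3) ε^(1/3)`. -/
noncomputable def ofRadius (ρ : ℝ) (P : Prices) (centre : Set (Vec d) → Vec d) (e : Vec d) (τ : ℝ)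
    (eig : (Vec d →L[ℝ] Vec d) → Vec d) (f : Vec d → ℝ) (ε L₁ L₃ : ℝ) : Setup d :=
  ⟨P, centre, e, τ, eig, f, ε, L₁, L₃, ρ * L₃ ^ (-1 / 3 : ℝ) * ε ^ (1 / 3 : ℝ)⟩

variable {ρ : ℝ} {P : Prices} {centre : Set (Vec d) → Vec d} {e : Vec d} {τ : ℝ}
    {eig : (Vec d →L[ℝ] Vec d) → Vec d} {f : Vec d → ℝ} {ε L₁ L₃ : ℝ}

/-- Replacing `L₃` and `ε` by cubes turns the fractional powers into rational expressions. -/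
theorem rpow_third_facts {x : ℝ} (hx : 0 < x) : ∃ a : ℝ, 0 < a ∧ x = a ^ 3 ∧
    x ^ (1 / 3 : ℝ) = a ∧ x ^ (-1 / 3 : ℝ) = a⁻¹ ∧ x ^ (2 / 3 : ℝ) = a ^ 2 ∧
    x ^ (-4 / 3 : ℝ) = (a ^ 4)⁻¹ := by
  have h (n : ℕ) : (x ^ (1 / 3 : ℝ)) ^ n = x ^ (n / 3 : ℝ) := by
    rw [← Real.rpow_natCast, ← Real.rpow_mul hx.le]
    congr 1
    ring
  refine ⟨x ^ (1 / 3 : ℝ), by positivity, ?_, rfl, ?_, ?_, ?_⟩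
  · rw [h]
    norm_num
  · rw [← Real.rpow_neg hx.le]
    norm_num
  · rw [h]
    norm_num
  · rw [h, ← Real.rpow_neg hx.le]
    norm_num

theorem pen_ofRadius (hL₃ : 0 < L₃) (hε : 0 < ε) :
    (ofRadius ρ P centre e τ eig f ε L₁ L₃).pen =
      21 * ρ ^ 2 * (L₃ ^ (1 / 3 : ℝ) * ε ^ (2 / 3 : ℝ)) := by
  obtain ⟨a, ha, h1, h2, h3, h4, h5⟩ := rpow_third_facts hL₃
  obtain ⟨b, hb, g1, g2, g3, g4, g5⟩ := rpow_third_facts hε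
  unfold pen ofRadius
  simp only
  rw [h3, g2, h2, g4, h1]
  field_simp

/-- With `L₃ = a³` and `ε = b³`, both terms of the minimum are multiples of `b⁴/a`: for this radius
the two sources of decrease scale alike. -/
theorem decrease_ofRadius (hρ : 0 < ρ) (hL₃ : 0 < L₃) (hε : 0 < ε) (Δ : ℝ) :
    Δ / (ofRadius ρ P centre e τ eig f ε L₁ L₃).decrease =
      (min (1 / (168 * ρ ^ 2)) (10 * ρ ^ 4))⁻¹ * (Δ * L₃ ^ (1 / 3 : ℝ) * ε ^ (-4 / 3 : ℝ)) := by
  have hp := pen_ofRadius (ρ := ρ) (P := P) (centre := centre) (e := e) (τ := τ) (eig := eig)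
    (f := f) (L₁ := L₁) hL₃ hε
  unfold decrease
  rw [hp]
  unfold ofRadius
  simp only
  obtain ⟨a, ha, h1, h2, h3, h4, h5⟩ := rpow_third_facts hL₃
  obtain ⟨b, hb, g1, g2, g3, g4, g5⟩ := rpow_third_facts hε
  rw [h3, g2, h2, g4, g5, h1, g1]
  have e1 : (b ^ 3) ^ 2 / (8 * (21 * ρ ^ 2 * (a * b ^ 2))) = 1 / (168 * ρ ^ 2) * (b ^ 4 / a) := by
    field_simp
    norm_num
  have e2 : 10 * a ^ 3 * (ρ * a⁻¹ * b) ^ 4 = 10 * ρ ^ 4 * (b ^ 4 / a) := by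
    field_simp
  rw [e1, e2, ← min_mul_of_nonneg _ _ (by positivity)]
  have : 0 < min (1 / (168 * ρ ^ 2)) (10 * ρ ^ 4) := lt_min (by positivity) (by positivity)
  field_simp

/-- The argument of the logarithm is affine in `L₁ / (L₃^(1/3) ε^(2/3))`, the cube root of `L₁³ /
(ε² L₃)`. The factor `2` absorbs the rounding up. -/
theorem steps_ofRadius_le (hd : 0 < d) (hτ : 0 < τ) (hτ' : τ ≤ 1 / 2) (hρ : 0 < ρ) (hL₁ : 0 < L₁)
    (hL₃ : 0 < L₃) (hε : 0 < ε) :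
    ((ofRadius ρ P centre e τ eig f ε L₁ L₃).steps : ℝ) ≤
      2 * ((1 + |Real.log (32 * ρ + 672 * ρ ^ 3)|) * (d / τ) *
        logPlus (L₁ ^ 3 / (ε ^ 2 * L₃))) := by
  have hd1 : (1 : ℝ) ≤ d := by exact_mod_cast hd
  have hq : 1 ≤ (d : ℝ) / τ := by
    rw [one_le_div hτ]
    linarith
  obtain ⟨a, ha, h1, h2, h3, h4, h5⟩ := rpow_third_facts hL₃
  obtain ⟨b, hb, g1, g2, g3, g4, g5⟩ := rpow_third_facts hε
  have hx : 0 < L₁ / (a * b ^ 2) := by positivity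
  have h := logPlus_affine_le hρ hx
  have hX : (L₁ / (a * b ^ 2)) ^ 3 = L₁ ^ 3 / (ε ^ 2 * L₃) := by
    rw [h1, g1]
    field_simp
  have hY : 16 * (ofRadius ρ P centre e τ eig f ε L₁ L₃).smooth *
      (ofRadius ρ P centre e τ eig f ε L₁ L₃).R / (ε / 2) =
        32 * ρ * (L₁ / (a * b ^ 2)) + 672 * ρ ^ 3 := by
    rw [smooth, pen_ofRadius hL₃ hε]
    unfold ofRadius
    simp only
    rw [h3, g2, h2, g4, g1]
    field_simp
    ring
  rw [hX] at h
  set C₁ := 1 + |Real.log (32 * ρ + 672 * ρ ^ 3)| with hC₁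
  have hC : 1 ≤ C₁ := le_add_of_nonneg_right (abs_nonneg _)
  have hℓ := one_le_logPlus (L₁ ^ 3 / (ε ^ 2 * L₃))
  set ℓ := logPlus (L₁ ^ 3 / (ε ^ 2 * L₃))
  have hs : (1 : ℝ) ≤ C₁ * (d / τ) * ℓ :=
    one_le_mul_of_one_le_of_one_le (one_le_mul_of_one_le_of_one_le hC hq) hℓ
  have hle : (d : ℝ) / τ * logPlus (32 * ρ * (L₁ / (a * b ^ 2)) + 672 * ρ ^ 3) ≤
      C₁ * (d / τ) * ℓ := by
    calc _ ≤ (d : ℝ) / τ * (C₁ * ℓ) := by gcongr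
      _ = C₁ * (d / τ) * ℓ := by ring
  have hceil : ((ofRadius ρ P centre e τ eig f ε L₁ L₃).steps : ℝ) <
      (d : ℝ) / τ * logPlus (32 * ρ * (L₁ / (a * b ^ 2)) + 672 * ρ ^ 3) + 1 := by
    rw [← hY]
    refine Nat.ceil_lt_add_one (mul_nonneg (by positivity) ?_)
    exact zero_le_one.trans (one_le_logPlus _)
  linarith

end Setup

end CutNC

/-! ### Assembly of the complexity bound -/

open CutNC in
theorem mainTheorem1 (ρ : ℝ) (hρ : 0 < ρ) (c : ℝ≥0) :
    ∃ C : ℝ, 0 < C ∧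
      ∀ (d : ℕ) (_ : 0 < d)
        -- the prices of the primitive operations
        (ω : ℝ) (_ : 2 ≤ ω) (_ : ω ≤ 3) (T1 T2 TC : ℝ≥0) (_ : (d : ℝ≥0) ≤ c * T1)
        -- the subroutines
        (centre : Set (CutNC.Vec d) → CutNC.Vec d) (e : CutNC.Vec d) (_ : e ≠ 0) (τ : ℝ)
        (_ : CutNC.CuttingPlaneAssumption ⟨c, ω, T1, T2, TC⟩ centre e τ)
        (eig : (CutNC.Vec d →L[ℝ] CutNC.Vec d) → CutNC.Vec d) (_ : CutNC.IsMinDirection eig)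
        -- the function and the parameters
        (f : CutNC.Vec d → ℝ) (z₀ : CutNC.Vec d) (L₁ L₃ ε Δ : ℝ)
        (_ : 0 < L₁) (_ : 0 < L₃) (_ : 0 < ε)
        (_ : CutNC.HasLipschitzDeriv 1 L₁ f) (_ : CutNC.HasLipschitzDeriv 3 L₃ f)
        (_ : BddBelow (Set.range f)) (_ : f z₀ - ⨅ x, f x ≤ Δ)
        -- the source of randomness
        (Ω : Type*) (_ : MeasurableSpace Ω) (Pr : Measure Ω) (_ : IsProbabilityMeasure Pr)
        (ξ : ℕ → ℕ → Ω → CutNC.Vec d) (_ : ∀ t k, Measurable (ξ t k))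
        (_ : ∀ t k, pdf.IsUniform (ξ t k) (Metric.closedBall 0 1) Pr volume)
        (_ : iIndepFun (fun i : ℕ × ℕ => ξ i.1 i.2) Pr),
        ∃ Kbar : Ω → ℝ, Measurable Kbar ∧ (∀ w, 0 < Kbar w) ∧
          (∀ y : ℝ, Pr.real {w | y ≤ Kbar w} ≤ Real.exp ((1 - y) / 10)) ∧
          ∀ᵐ w ∂Pr, ∃ m : ℕ,
            let run := CutNC.repeatedCalls ⟨c, ω, T1, T2, TC⟩ centre e τ eig f z₀ ε L₁ L₃
              (ρ * L₃ ^ (-1 / 3 : ℝ) * ε ^ (1 / 3 : ℝ)) (fun t k => ξ t k w)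
            IsLeast {t : ℕ | CutNC.IsApproxStationary f ε
              (21 * ρ ^ 2 * (L₃ ^ (1 / 3 : ℝ) * ε ^ (2 / 3 : ℝ))) (run t).val} m ∧
            (run m).time ≤ ENNReal.ofReal
              (C * ((Δ * L₃ ^ (1 / 3 : ℝ) * ε ^ (-4 / 3 : ℝ) + 1) *
                ((TC + T1 + Kbar w * d) * d / τ * CutNC.logPlus (L₁ ^ 3 / (ε ^ 2 * L₃))
                  + T2 + (d : ℝ) ^ ω))) := by
  classical
  have hκ : 0 < min (1 / (168 * ρ ^ 2)) (10 * ρ ^ 4) := lt_min (by positivity) (by positivity)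
  set κ := min (1 / (168 * ρ ^ 2)) (10 * ρ ^ 4)
  set C₁ := 1 + |Real.log (32 * ρ + 672 * ρ ^ 3)| with hC₁
  have hC : 1 ≤ C₁ := le_add_of_nonneg_right (abs_nonneg _)
  set E : ℝ := 9 * (1 + 12 * (c : ℝ) ^ 2) + 2 + 443 * c with hE
  have hE0 : 0 < E := by positivity
  refine ⟨(κ⁻¹ + 2) * (E * C₁), by positivity, ?_⟩
  intro d hd ω _ _ T1 T2 TC hdT centre e _ τ hcut eig heig f z₀ L₁ L₃ ε Δ hL₁ hL₃ hε hf1 hf3 hbdd hΔ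
    Ω _ Pr _ ξ hξ hu hi
  set A : Setup d := Setup.ofRadius ρ ⟨c, ω, T1, T2, TC⟩ centre e τ eig f ε L₁ L₃
  have hA : A.Valid := ⟨hd, hcut, heig, hL₁, hL₃, hε, by
    change 0 < ρ * L₃ ^ (-1 / 3 : ℝ) * ε ^ (1 / 3 : ℝ)
    positivity, hf1, hf3⟩
  have hpen : A.pen = 21 * ρ ^ 2 * (L₃ ^ (1 / 3 : ℝ) * ε ^ (2 / 3 : ℝ)) := Setup.pen_ofRadius hL₃ hε
  have hΔ0 : 0 ≤ Δ := (sub_nonneg.2 (ciInf_le hbdd z₀)).trans hΔ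
  set D := Δ * L₃ ^ (1 / 3 : ℝ) * ε ^ (-4 / 3 : ℝ) with hD
  have hD0 : 0 ≤ D := by positivity
  have hdec : Δ / A.decrease = κ⁻¹ * D := Setup.decrease_ofRadius hρ hL₃ hε Δ
  -- A deterministic horizon that exhausts `Δ`: the stopping index is random, so the variable
  -- bounding the draws is built for `n` calls, and a run stopped earlier uses no more draws.
  set n := ⌊κ⁻¹ * D⌋₊ + 1 with hn
  have hn1 : Δ < n * A.decrease := by
    rw [← div_lt_iff₀ hA.decrease_pos, hdec, hn]
    exact_mod_cast Nat.lt_floor_add_one (κ⁻¹ * D)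
  have hn2 : (n : ℝ) + 1 ≤ (κ⁻¹ + 2) * (D + 1) := by
    have h1 : (⌊κ⁻¹ * D⌋₊ : ℝ) ≤ κ⁻¹ * D := Nat.floor_le (by positivity)
    have h2 : 0 ≤ κ⁻¹ := by positivity
    rw [hn]
    push_cast
    linarith
  obtain ⟨Kbar, hK1, hK2, hK3, hK4⟩ := hA.exists_trials_bound z₀ hξ hu hi (Nat.succ_pos _ : 0 < n)
  refine ⟨Kbar, hK1, hK2, hK3, ?_⟩
  have hball : ∀ᵐ w ∂Pr, ∀ t k, ‖ξ t k w‖ ≤ 1 :=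
    ae_all_iff.2 fun t => ae_all_iff.2 fun k => Setup.ae_norm_le_one (hξ t k) (hu t k)
  filter_upwards [hK4, hball] with w hw hwb
  obtain ⟨hacc, htr⟩ := hw
  have hex := hA.exists_stationary hbdd hΔ hn1 hwb hacc
  rw [hpen] at hex
  have hex' : ∃ m, IsApproxStationary f ε (21 * ρ ^ 2 * (L₃ ^ (1 / 3 : ℝ) * ε ^ (2 / 3 : ℝ)))
      (A.run z₀ (fun t k => ξ t k w) m).val := by
    obtain ⟨m, _, hm⟩ := hex
    exact ⟨m, by rw [Setup.run_val]; exact hm⟩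
  have hmn : Nat.find hex' ≤ n := by
    obtain ⟨m, hmn, hm⟩ := hex
    exact (Nat.find_min' hex' (by rw [Setup.run_val]; exact hm)).trans hmn
  refine ⟨Nat.find hex', ⟨Nat.find_spec hex', fun t ht => Nat.find_min' hex' ht⟩, ?_⟩
  set m := Nat.find hex'
  change (A.run z₀ (fun t k => ξ t k w) m).time ≤ _
  refine (A.run_time_le z₀ _ m fun t ht => hacc t (ht.trans_le hmn)).trans ?_
  rw [← ENNReal.ofReal_coe_nnreal]
  refine ENNReal.ofReal_le_ofReal ?_
  have htm : A.trials z₀ (fun t k => ξ t k w) m ≤ A.trials z₀ (fun t k => ξ t k w) n :=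
    Finset.sum_le_sum_of_subset (Finset.range_subset_range.2 hmn)
  have htm' : (A.trials z₀ (fun t k => ξ t k w) m : ℝ) ≤ 40 * n * Kbar w :=
    (Nat.cast_le.2 htm).trans htr
  have hdR : (1 : ℝ) ≤ d := by exact_mod_cast hd
  have hq : 1 ≤ (d : ℝ) / τ := by
    rw [one_le_div hcut.tau_pos]
    linarith [hcut.tau_le]
  have hdT' : (d : ℝ) ≤ c * T1 := by exact_mod_cast hdT
  have hN : (A.steps : ℝ) ≤ 2 * (C₁ * (d / τ) * logPlus (L₁ ^ 3 / (ε ^ 2 * L₃))) :=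
    Setup.steps_ofRadius_le hd hcut.tau_pos hcut.tau_le hρ hL₁ hL₃ hε
  have hdω : (0 : ℝ) ≤ (d : ℝ) ^ ω := by positivity
  have htot : ((n : ℝ) + 1) * A.callPrice +
      A.trials z₀ (fun t k => ξ t k w) m * ((2 * A.steps + 7) * (A.P.vec d : ℝ)) ≤
        ((n : ℝ) + 1) * (E * C₁ * ((TC + T1 + Kbar w * d) * (d / τ) *
          logPlus (L₁ ^ 3 / (ε ^ 2 * L₃)) + T2 + (d : ℝ) ^ ω)) := total_price_le (n := n) (t := A.trials z₀ (fun t k => ξ t k w) m) (ω := ω)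
    (Nat.cast_nonneg n) (hK2 w).le (Nat.cast_nonneg d) c.2 T1.2 T2.2 TC.2 hdω hC hq
    (one_le_logPlus _) hdT' hN (Nat.cast_nonneg _) htm'
  have hmn' : (m : ℝ) ≤ n := by exact_mod_cast hmn
  push_cast
  refine (add_le_add (mul_le_mul_of_nonneg_right (by linarith) A.callPrice.2) le_rfl).trans
    (htot.trans ?_)
  have hnonneg : 0 ≤ (TC + T1 + Kbar w * d) * d / τ * logPlus (L₁ ^ 3 / (ε ^ 2 * L₃))
      + T2 + (d : ℝ) ^ ω := by
    have h1 := (hK2 w).le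
    have h2 := hcut.tau_pos
    have h3 := zero_le_one.trans (one_le_logPlus (L₁ ^ 3 / (ε ^ 2 * L₃)))
    positivity
  calc ((n : ℝ) + 1) * (E * C₁ * ((TC + T1 + Kbar w * d) * (d / τ) *
        logPlus (L₁ ^ 3 / (ε ^ 2 * L₃)) + T2 + (d : ℝ) ^ ω))
      = ((n : ℝ) + 1) * (E * C₁ * ((TC + T1 + Kbar w * d) * d / τ *
        logPlus (L₁ ^ 3 / (ε ^ 2 * L₃)) + T2 + (d : ℝ) ^ ω)) := by rw [mul_div_assoc]
    _ ≤ (κ⁻¹ + 2) * (D + 1) * (E * C₁ * ((TC + T1 + Kbar w * d) * d / τ *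
        logPlus (L₁ ^ 3 / (ε ^ 2 * L₃)) + T2 + (d : ℝ) ^ ω)) := by gcongr
    _ = _ := by ring
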